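/- Proposition 3.4. Let $M$ be a connected smooth manifold of dimension $m\ge 2$ (Hausdorff, second countable), and let $g_0$ be a smooth symmetric covariant $2$-tensor field on $M$ such that $(M,g_0)$ is a *transverse Riemann–Lorentz manifold*: the set $\Sigma$ of points where $g_0$ degenerates is non-empty, $d_p(\det(g_{0,ab}))\ne 0$ in local coordinates at each $p\in\Sigma$ (so $\Sigma$ is a hypersurface with one-dimensional radicals $\mathrm{Rad}_p=T_pM^{\perp}$, $p\in\Sigma$), and at each point of $M\setminus\Sigma$ the form $g_0$ is Riemannian or Lorentzian (index $0$ or $1$). Assume that the radical is transverse, i.e. $\mathrm{Rad}_p\not\subset T_p\Sigma$ for all $p\in\Sigma$, and let $\mathcal C=\{e^{2f}g_0: f\in C^\infty(M)\}$; every $g\in\mathcal C$ has the same $\Sigma$ and the same radicals. For $g\in\mathcal C$ let $\square_XY(Z)$ be half the right-hand side of the Koszul formula, $$2\,\square_XY(Z)=Xg(Y,Z)+Yg(X,Z)-Zg(X,Y)+g([X,Y],Z)-g([X,Z],Y)-g([Y,Z],X),$$ so that $\square_XY(Z)=g(\nabla_XY,Z)$ on $M\setminus\Sigma$, where $\nabla$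 is the Levi-Civita connection there. A vector field $R$ on an open set $U\subset M$ is *radical* if $R_p\in\mathrm{Rad}_p\setminus\{0\}$ for all $p\in\Sigma\cap U$; put $II^R(X,Y)=\square_XY(R)|_{\Sigma\cap U}$, and let $II^R_\Sigma$ be its restriction to vector fields tangent to $\Sigma$. Let $g_\Sigma$ be the restriction of $g$ to $T\Sigma$. * $g$ is *$II$-flat on $U$* if $II^R_\Sigma=0$ on $\Sigma\cap U$ for some radical $R$ on $U$. In that case, for $X,Y$ tangent to $\Sigma$, $\nabla_XY$ extends smoothly across $\Sigma\cap U$, and $III^R(X,Y):=II^R(\nabla_XY,R)$ is defined on $\Sigma\cap U$. * $g$ is *$III$-flat on $U$* if it is $II$-flat on $U$ and $III^R=0$ on $\Sigma\cap U$ for some radical $R$ on $U$. * $g$ is *conformally $III$-flat on $U$* if it is $II$-flat on $U$ and $III^R=k\,g_\Sigma$ on $\Sigma\cap U$ for some radical $R$ on $U$ and some $k\in C^\infty(\Sigma\cap U)$. * $(M,\mathcal C)$ is *conformally $II$-flat* if for some $g\in\mathcal C$ there are a radical vector field $R$ on $M$ and $h\in C^\infty(\Sigma)$ with $II^R_\Sigma=h\,g_\Sigma$.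 * $(M,\mathcal C)$ is *conformally $III$-flat* if it is conformally $II$-flat and, for every open $U\subset M$, every $g\in\mathcal C$ that is $II$-flat on $U$ is also conformally $III$-flat on $U$. Then $(M,\mathcal C)$ is conformally $III$-flat if and only if for every $p\in\Sigma$ there exist an open neighbourhood $U$ of $p$ in $M$ and a metric $g\in\mathcal C$ which is $III$-flat on $U$. -/

import Mathlib

open scoped Manifold ContDiff Bundle

noncomputable section

namespace RiemannLorentz

/-- A smooth symmetric covariant tensor field of order 2 on the `m`-dimensional manifold `M`.
No nondegeneracy is required. -/
structure MetricTensor (m : ℕ) (M : Type*) [TopologicalSpace M]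
    [ChartedSpace (EuclideanSpace ℝ (Fin m)) M] [IsManifold (𝓡 m) ∞ M] where
  /-- The bilinear form on each tangent space. -/
  val (p : M) : TangentSpace (𝓡 m) p →L[ℝ] TangentSpace (𝓡 m) p →L[ℝ] ℝ
  symm (p : M) (v w : TangentSpace (𝓡 m) p) : val p v w = val p w v
  contMDiff : ContMDiff (𝓡 m)
    ((𝓡 m).prod 𝓘(ℝ, EuclideanSpace ℝ (Fin m) →L[ℝ] EuclideanSpace ℝ (Fin m) →L[ℝ] ℝ)) ∞
    (fun p ↦ Bundle.TotalSpace.mk'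
      (EuclideanSpace ℝ (Fin m) →L[ℝ] EuclideanSpace ℝ (Fin m) →L[ℝ] ℝ) p (val p))

section

variable {m : ℕ} {M : Type*} [TopologicalSpace M]
  [ChartedSpace (EuclideanSpace ℝ (Fin m)) M] [IsManifold (𝓡 m) ∞ M]

/-- `X` is a smooth vector field on the open set `U` (its values outside `U` are irrelevant). -/
def IsSmoothFieldOn (X : Π p : M, TangentSpace (𝓡 m) p) (U : Set M) : Prop :=
  ContMDiffOn (𝓡 m) (𝓡 m).tangent ∞
    (fun p ↦ (Bundle.TotalSpace.mk' (EuclideanSpace ℝ (Fin m)) p (X p) :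
      TangentBundle (𝓡 m) M)) U

variable (m) in
/-- `h` is a smooth function on the subset `S` of `M`: around each point of `S` it is the
restriction to `S` of a smooth function on an open subset of `M`. (If `S` is an embedded
submanifold, this is smoothness on the manifold `S`.) -/
def IsSmoothFunctionOnSubset (h : M → ℝ) (S : Set M) : Prop :=
  ∀ p ∈ S, ∃ (V : Set M) (h' : M → ℝ), IsOpen V ∧ p ∈ V ∧
    ContMDiffOn (𝓡 m) 𝓘(ℝ, ℝ) ∞ h' V ∧ ∀ q ∈ V ∩ S, h' q = h q

variable (m) in
/-- The coordinate vector fields `∂_a` of the preferred chart at `p`, near `p`. -/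
def coordField (p : M) (a : Fin m) : Π q : M, TangentSpace (𝓡 m) q :=
  (trivializationAt (EuclideanSpace ℝ (Fin m)) (TangentSpace (𝓡 m)) p).localFrame
    (EuclideanSpace.basisFun (Fin m) ℝ).toBasis a

namespace MetricTensor

variable (g : MetricTensor m M)

/-- The radical of `g` at `p`: the vectors that are `g`-orthogonal to the whole `T_p M`. -/
def radical (p : M) : Set (TangentSpace (𝓡 m) p) :=
  {ξ | ∀ w, g.val p ξ w = 0}

/-- The singular set `Σ`: the points where `g` degenerates. -/
def sing : Set M :=
  {p | ∃ ξ ∈ g.radical p, ξ ≠ 0}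

/-- The function `q ↦ det (g_ab(q))` in the preferred coordinates at `p`. -/
def gramDet (p q : M) : ℝ :=
  (Matrix.of fun a b : Fin m ↦ g.val q (coordField m p a q) (coordField m p b q)).det

/-- The differential at `p` of `det (g_ab)`. -/
def dGramDet (p : M) : TangentSpace (𝓡 m) p →L[ℝ] ℝ :=
  mvfderiv (𝓡 m) (g.gramDet p) p

/-- `g_p` is positive definite. -/
def IsRiemannianAt (p : M) : Prop :=
  ∀ v : TangentSpace (𝓡 m) p, v ≠ 0 → 0 < g.val p v v

/-- `g_p` is nondegenerate of index one: there is a negative vector whose `g`-orthogonal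
complement is positive definite. -/
def IsLorentzianAt (p : M) : Prop :=
  ∃ v : TangentSpace (𝓡 m) p, g.val p v v < 0 ∧
    ∀ w : TangentSpace (𝓡 m) p, g.val p v w = 0 → w ≠ 0 → 0 < g.val p w w

/-- `(M, g)` is a transverse Riemann-Lorentz manifold: the singular set is nonempty,
`d (det (g_ab)) ≠ 0` at each singular point, and off the singular set `g` is Riemannian or
Lorentzian. (As the index jumps by one across `Σ`, then `Σ` separates locally a Riemannian
part from a Lorentzian one.) -/
structure IsTransverseRiemannLorentz : Prop where
  sing_nonempty : g.sing.Nonempty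
  dGramDet_ne_zero : ∀ p ∈ g.sing, g.dGramDet p ≠ 0
  riemannian_or_lorentzian : ∀ p ∉ g.sing, g.IsRiemannianAt p ∨ g.IsLorentzianAt p

/-- The tangent space at a singular point `p` of the hypersurface `Σ`, which near `p` is the
regular zero set of `det (g_ab)`. -/
def singTangent (p : M) : Set (TangentSpace (𝓡 m) p) :=
  {v | g.dGramDet p v = 0}

/-- The radical is transverse to `Σ` at each singular point. -/
def HasTransverseRadical : Prop :=
  ∀ p ∈ g.sing, ∀ ξ ∈ g.radical p, ξ ≠ 0 → ξ ∉ g.singTangent p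

/-- `R` is a radical vector field on the open set `U`. -/
def IsRadicalFieldOn (R : Π p : M, TangentSpace (𝓡 m) p) (U : Set M) : Prop :=
  IsSmoothFieldOn R U ∧ ∀ p ∈ g.sing ∩ U, R p ∈ g.radical p ∧ R p ≠ 0

/-- `X` is a smooth vector field on the open set `U` which is tangent to `Σ` along `Σ ∩ U`;
the restrictions of such fields are (locally) the vector fields of the manifold `Σ ∩ U`. -/
def IsSingTangentFieldOn (X : Π p : M, TangentSpace (𝓡 m) p) (U : Set M) : Prop :=
  IsSmoothFieldOn X U ∧ ∀ p ∈ g.sing ∩ U, X p ∈ g.singTangent p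

/-- The dual connection `□_X Y (Z)`, given by the Koszul formula. -/
def dualConn (X Y Z : Π p : M, TangentSpace (𝓡 m) p) (p : M) : ℝ :=
  (1 / 2) *
    (mvfderiv (𝓡 m) (fun q ↦ g.val q (Y q) (Z q)) p (X p)
      + mvfderiv (𝓡 m) (fun q ↦ g.val q (X q) (Z q)) p (Y p)
      - mvfderiv (𝓡 m) (fun q ↦ g.val q (X q) (Y q)) p (Z p)
      + g.val p (VectorField.mlieBracket (𝓡 m) X Y p) (Z p)
      - g.val p (VectorField.mlieBracket (𝓡 m) X Z p) (Y p)
      - g.val p (VectorField.mlieBracket (𝓡 m) Y Z p) (X p))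

/-- `II^R(X, Y) = □_X Y (R)`, to be evaluated at singular points, with `R` radical. -/
def II (R X Y : Π p : M, TangentSpace (𝓡 m) p) (p : M) : ℝ :=
  g.dualConn X Y R p

/-- `II_Σ = 0` on `Σ ∩ U`: the tensor `g` is `II`-flat on the open set `U`. -/
def IsIIFlatOn (U : Set M) : Prop :=
  ∃ R, g.IsRadicalFieldOn R U ∧
    ∀ X Y, g.IsSingTangentFieldOn X U → g.IsSingTangentFieldOn Y U →
      ∀ p ∈ g.sing ∩ U, g.II R X Y p = 0

/-- `II_Σ^R = h g_Σ` on the whole `Σ`, for some radical `R` and some smooth function `h`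
on `Σ`. -/
def IsConformallyIIFlat : Prop :=
  ∃ R, g.IsRadicalFieldOn R Set.univ ∧ ∃ h : M → ℝ, IsSmoothFunctionOnSubset m h g.sing ∧
    ∀ X Y, g.IsSingTangentFieldOn X Set.univ → g.IsSingTangentFieldOn Y Set.univ →
      ∀ p ∈ g.sing, g.II R X Y p = h p * g.val p (X p) (Y p)

/-- `D` is a smooth vector field on the open set `V` which, at the nonsingular points of `V`,
is the Levi-Civita covariant derivative `∇_X Y`. As the nonsingular points are dense, such a
`D` is unique on `V`. -/
def ExtendsCovDerivOn (X Y D : Π p : M, TangentSpace (𝓡 m) p) (V : Set M) : Prop :=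
  IsSmoothFieldOn D V ∧ ∀ q ∈ V \ g.sing, ∀ Z, IsSmoothFieldOn Z V →
    g.val q (D q) (Z q) = g.dualConn X Y Z q

/-- `III^R(X, Y)(p) = c` for vector fields on the open set `U`: the covariant derivative
`∇_X Y` extends smoothly across `Σ` around the singular point `p`, and the extension,
written again `∇_X Y`, has `II^R(∇_X Y, R)(p) = c`. -/
def HasIIIAt (U : Set M) (R X Y : Π p : M, TangentSpace (𝓡 m) p) (p : M) (c : ℝ) : Prop :=
  ∃ V ⊆ U, IsOpen V ∧ p ∈ V ∧ ∃ D, g.ExtendsCovDerivOn X Y D V ∧ g.II R D R p = c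

/-- `g` is `III`-flat on the open set `U`: it is `II`-flat on `U` and `III^R = 0` on `Σ ∩ U`. -/
def IsIIIFlatOn (U : Set M) : Prop :=
  g.IsIIFlatOn U ∧ ∃ R, g.IsRadicalFieldOn R U ∧
    ∀ X Y, g.IsSingTangentFieldOn X U → g.IsSingTangentFieldOn Y U →
      ∀ p ∈ g.sing ∩ U, g.HasIIIAt U R X Y p 0

/-- `g` is conformally `III`-flat on the open set `U`: it is `II`-flat on `U` and
`III^R = k g_Σ` on `Σ ∩ U`, for some radical `R` and some smooth function `k` on `Σ ∩ U`. -/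
def IsConformallyIIIFlatOn (U : Set M) : Prop :=
  g.IsIIFlatOn U ∧ ∃ R, g.IsRadicalFieldOn R U ∧
    ∃ k : M → ℝ, IsSmoothFunctionOnSubset m k (g.sing ∩ U) ∧
      ∀ X Y, g.IsSingTangentFieldOn X U → g.IsSingTangentFieldOn Y U →
        ∀ p ∈ g.sing ∩ U, g.HasIIIAt U R X Y p (k p * g.val p (X p) (Y p))

/-- The conformal class `{e^{2f} g : f ∈ C^∞(M)}`. -/
def conformalClass : Set (MetricTensor m M) :=
  {g' | ∃ f : M → ℝ, ContMDiff (𝓡 m) 𝓘(ℝ, ℝ) ∞ f ∧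
    ∀ (p : M) (v w : TangentSpace (𝓡 m) p),
      g'.val p v w = Real.exp (2 * f p) * g.val p v w}

end MetricTensor

/-- A conformal class is conformally `II`-flat if some metric in it is. -/
def IsConformallyIIFlatClass (C : Set (MetricTensor m M)) : Prop :=
  ∃ g ∈ C, g.IsConformallyIIFlat

/-- A conformal class (with transverse radical) is conformally `III`-flat if it is conformally
`II`-flat and each metric in it that is `II`-flat on some open set is also conformally
`III`-flat on that open set. -/
def IsConformallyIIIFlatClass (C : Set (MetricTensor m M)) : Prop :=
  IsConformallyIIFlatClass C ∧
    ∀ g ∈ C, ∀ U : Set M, IsOpen U → g.IsIIFlatOn U → g.IsConformallyIIIFlatOn U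

end

end RiemannLorentz

end

/-!
Write `Σ` for the singular set, `D` for the differential of the determinant of `g` at points of `Σ`
and `□` for the dual connection. The radical is a line, and it is transverse to `Σ`.

*What the two forms measure.* For a radical field `R` put `ρ = g(R, R)`. Along `Σ` the differential
of `ρ` is a nonzero multiple of `D` (`exists_mvfderiv_val_eq`), and `□_V R(R) = V(ρ) / 2`. Hence
`III^R(X, Y) = dρ(∇_X Y) / 2`, which vanishes exactly if the extension of `∇_X Y` is tangent to `Σ`.

*Conformal changes.* Let `g' = e^{2f} g`. Along `Σ` the Koszul formula gives
`II'^R = e^{2f} (II^R - R(f) g)` (`IsConformalChange.II_apply`). If `df` annihilates the radical,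
then the gradient `N` of `f` extends smoothly across `Σ` (`HasRegularSing.exists_gradient`): in
coordinates it is `adj(G) df / det G`, the numerator vanishes on the regular zero set `Σ` of
`det G`, and Hadamard's lemma (`hadamard_division`) applies. From
`∇'_X Y = ∇_X Y + X(f) Y + Y(f) X - g(X, Y) N` it follows that
`III'^R(X, Y) = e^{2f} (III^R(X, Y) - g(X, Y) dρ(N) / 2)` (`HasIIIAt.conformalChange`). Thus `II`
can be changed by the multiple `R(f)` of `g_Σ`, and after that `III` by the multiple `dρ(N) / 2`.

*From the class to local metrics.* If `II^R = h g_Σ`, then `f = ρ h / R(ρ)` has `R(f) = h` along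
`Σ`, so it makes the metric `II`-flat locally (`HasRegularSing.exists_isIIFlatOn`). The new metric
has `III^R = k g_Σ` by hypothesis, and `f = ρ² k / R(ρ)²` satisfies `df = 0` and `dρ(N) / 2 = k`
along `Σ`, so it makes the metric `III`-flat (`HasRegularSing.exists_isIIIFlatOn`).

*From local metrics to the class.* Local radical fields, oriented by `R(ρ) > 0`, are patched by a
partition of unity (`HasRegularSing.exists_global_radical`). The local formula for a conformal
change shows `II^R = h g_Σ` and, for a `II`-flat metric of the class, `III^R = k g_Σ` near each
point. Since `m ≥ 2`, the form `g_Σ` vanishes nowhere, so that `h` and `k` are unique and the local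
functions fit together. For `k` this also uses that `Σ` has empty interior, which makes the
extension of `∇_X Y` unique.
-/

open scoped Topology

noncomputable section

namespace RiemannLorentz

/-! ### Hadamard's lemma in a vector space -/

section Hadamard

variable {E : Type*} [NormedAddCommGroup E] [NormedSpace ℝ E]

omit [NormedSpace ℝ E] in
theorem continuous_parametric_integral {H : E × ℝ → ℝ} (hH : Continuous H) :
    Continuous fun z ↦ ∫ t in (0 : ℝ)..1, H (z, t) :=
  intervalIntegral.continuous_parametric_intervalIntegral_of_continuous'
    (f := fun z t ↦ H (z, t)) hH 0 1

/-- Differentiation under the integral sign, over a compact interval. -/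
theorem hasFDerivAt_parametric_integral [FiniteDimensional ℝ E] {H : E × ℝ → ℝ}
    (hH : ContDiff ℝ 1 H) (z₀ : E) :
    HasFDerivAt (fun z ↦ ∫ t in (0 : ℝ)..1, H (z, t))
      (∫ t in (0 : ℝ)..1, (fderiv ℝ H (z₀, t)).comp (.inl ℝ E ℝ)) z₀ := by
  have : ProperSpace E := FiniteDimensional.proper ℝ E
  have hF' : Continuous fun q : E × ℝ ↦ (fderiv ℝ H q).comp (ContinuousLinearMap.inl ℝ E ℝ) :=
    (hH.continuous_fderiv one_ne_zero).clm_comp continuous_const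
  obtain ⟨C, hC⟩ := ((isCompact_closedBall z₀ 1).prod (isCompact_Icc (a := (0 : ℝ)) (b := 1))
    ).exists_bound_of_continuousOn hF'.continuousOn
  refine (intervalIntegral.hasFDerivAt_integral_of_dominated_of_fderiv_le (𝕜 := ℝ)
    (F := fun z t ↦ H (z, t))
    (F' := fun z t ↦ (fderiv ℝ H (z, t)).comp (.inl ℝ E ℝ)) (bound := fun _ ↦ C)
    (Metric.closedBall_mem_nhds z₀ one_pos) ?_ ?_ ?_ ?_ ?_ ?_)
  · exact .of_forall fun z ↦
      (hH.continuous.comp (Continuous.prodMk_right z)).aestronglyMeasurable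
  · exact (hH.continuous.comp (Continuous.prodMk_right z₀)).intervalIntegrable _ _
  · exact (hF'.comp (Continuous.prodMk_right z₀)).aestronglyMeasurable
  · refine .of_forall fun t ht z hz ↦ hC (z, t) ⟨hz, ?_⟩
    rw [Set.uIoc_of_le zero_le_one] at ht
    exact ⟨ht.1.le, ht.2⟩
  · simp
  · refine .of_forall fun t _ z _ ↦ ?_
    exact ((hH.differentiable one_ne_zero) (z, t)).hasFDerivAt.comp z
      (hasFDerivAt_prodMk_left z t)

/-- An integral over a compact interval of a smooth function depends smoothly on parameters. -/
theorem contDiff_parametric_integral [FiniteDimensional ℝ E] {H : E × ℝ → ℝ}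
    (hH : ContDiff ℝ ∞ H) : ContDiff ℝ ∞ fun z ↦ ∫ t in (0 : ℝ)..1, H (z, t) := by
  rw [contDiff_infty]
  intro n
  induction n generalizing H with
  | zero => exact contDiff_zero.2 (continuous_parametric_integral hH.continuous)
  | succ n ih =>
    have h1 := hasFDerivAt_parametric_integral (hH.of_le (by simp))
    have hF' : Continuous fun q : E × ℝ ↦ (fderiv ℝ H q).comp (ContinuousLinearMap.inl ℝ E ℝ) :=
      (hH.continuous_fderiv (by simp)).clm_comp continuous_const
    push_cast
    rw [contDiff_succ_iff_fderiv_apply]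
    refine ⟨fun z ↦ (h1 z).differentiableAt, by simp, fun y ↦ ?_⟩
    have hH' : ContDiff ℝ ∞ fun q : E × ℝ ↦ fderiv ℝ H q (y, 0) :=
      (hH.fderiv_right (m := ∞) (by simp)).clm_apply contDiff_const
    convert! ih hH' using 2 with z
    rw [(h1 z).fderiv, ContinuousLinearMap.intervalIntegral_apply]
    · simp
    · exact (hF'.comp (Continuous.prodMk_right z)).intervalIntegrable _ _

/-- The increment of a smooth function `u` from `z - ℓ z • v` to `z` is a smooth multiple of the
linear form `ℓ`. If `ℓ v = 1`, then `z ↦ z - ℓ z • v` is the projection to the kernel of `ℓ`. -/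
theorem exists_sub_eq_mul_of_contDiff [FiniteDimensional ℝ E] {u : E → ℝ} (hu : ContDiff ℝ ∞ u)
    (ℓ : E →L[ℝ] ℝ) (v : E) :
    ∃ w : E → ℝ, ContDiff ℝ ∞ w ∧ ∀ z, u z - u (z - ℓ z • v) = ℓ z * w z := by
  let c : E × ℝ → E := fun q ↦ (q.1 - ℓ q.1 • v) + q.2 • (ℓ q.1 • v)
  have hc : ContDiff ℝ ∞ c := by
    have h1 : ContDiff ℝ ∞ fun q : E × ℝ ↦ ℓ q.1 := ℓ.contDiff.comp contDiff_fst
    exact (contDiff_fst.sub (h1.smul contDiff_const)).add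
      (contDiff_snd.smul (h1.smul contDiff_const))
  have hH : ContDiff ℝ ∞ fun q : E × ℝ ↦ fderiv ℝ u (c q) v :=
    ((hu.fderiv_right (m := ∞) (by simp)).comp hc).clm_apply contDiff_const
  refine ⟨_, contDiff_parametric_integral hH, fun z ↦ ?_⟩
  have hd : ∀ t : ℝ, HasDerivAt (fun t ↦ u (c (z, t))) (fderiv ℝ u (c (z, t)) (ℓ z • v)) t := by
    intro t
    have h2 : HasDerivAt (fun t ↦ c (z, t)) (ℓ z • v) t := by
      simpa [c] using ((hasDerivAt_id t).smul_const (ℓ z • v)).const_add (z - ℓ z • v)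
    exact ((hu.differentiable (by simp)) _).hasFDerivAt.comp_hasDerivAt t h2
  have hint : Continuous fun t : ℝ ↦ fderiv ℝ u (c (z, t)) (ℓ z • v) :=
    ((hu.continuous_fderiv (by simp)).comp (hc.continuous.comp (Continuous.prodMk_right z))
      ).clm_apply continuous_const
  have := intervalIntegral.integral_eq_sub_of_hasDerivAt (a := 0) (b := 1)
    (fun t _ ↦ hd t) (hint.intervalIntegrable _ _)
  simp only [map_smul, smul_eq_mul, intervalIntegral.integral_const_mul] at this
  rw [this]
  simp [c]

/-- Hadamard's lemma in a vector space: near a regular point of `τ`, a smooth function that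
vanishes on the zero set of `τ` is a smooth multiple of `τ`. -/
theorem hadamard_division_vectorSpace [FiniteDimensional ℝ E] {u τ : E → ℝ} {x : E} {O : Set E}
    (hO : IsOpen O) (hx : x ∈ O) (hu : ContDiffOn ℝ ∞ u O) (hτ : ContDiffOn ℝ ∞ τ O)
    (hx0 : τ x = 0) (hd : fderiv ℝ τ x ≠ 0) (h0 : ∀ y ∈ O, τ y = 0 → u y = 0) :
    ∃ (O' : Set E) (w : E → ℝ), IsOpen O' ∧ x ∈ O' ∧ O' ⊆ O ∧ ContDiffOn ℝ ∞ w O' ∧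
      ∀ y ∈ O', u y = τ y * w y := by
  set ℓ := fderiv ℝ τ x with hℓ
  obtain ⟨v, hv⟩ : ∃ v, ℓ v = 1 := by
    obtain ⟨v, hv⟩ := DFunLike.ne_iff.1 hd
    have hv : ℓ v ≠ 0 := hv
    exact ⟨(ℓ v)⁻¹ • v, by simp [hv]⟩
  -- The map `Φ` has derivative the identity at `x`, and `ℓ ∘ Φ = τ`.
  let Φ : E → E := fun y ↦ y + (τ y - ℓ y) • v
  have hℓΦ : ∀ y, ℓ (Φ y) = τ y := fun y ↦ by simp [Φ, hv]
  have hΦ : ContDiffOn ℝ ∞ Φ O :=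
    contDiffOn_id.add ((hτ.sub ℓ.contDiff.contDiffOn).smul contDiffOn_const)
  have hΦd : HasFDerivAt Φ ((ContinuousLinearEquiv.refl ℝ E : E ≃L[ℝ] E) : E →L[ℝ] E) x := by
    have h1 : HasFDerivAt τ ℓ x :=
      ((hτ.contDiffAt (hO.mem_nhds hx)).differentiableAt (by simp)).hasFDerivAt
    have := (hasFDerivAt_id x).add ((h1.sub ℓ.hasFDerivAt).smul_const v)
    convert! this using 1
    ext y
    simp
  have hΦs := (hΦ.contDiffAt (hO.mem_nhds hx)).hasStrictFDerivAt' hΦd (by simp)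
  let e := hΦs.toOpenPartialHomeomorph Φ
  have heΦ : ∀ y, e y = Φ y := fun _ ↦ rfl
  have hxe : x ∈ e.source := hΦs.mem_toOpenPartialHomeomorph_source
  have hinv : ∀ᶠ y in 𝓝 x, fderiv ℝ Φ y ∈ Set.range ((↑) : (E ≃L[ℝ] E) → E →L[ℝ] E) := by
    have hc : ContinuousAt (fderiv ℝ Φ) x :=
      (hΦ.continuousOn_fderiv_of_isOpen hO (by simp)).continuousAt (hO.mem_nhds hx)
    refine hc.eventually ?_
    rw [hΦd.fderiv]
    exact ContinuousLinearEquiv.nhds _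
  obtain ⟨O₁, hO₁, hO₁o, hxO₁⟩ := eventually_nhds_iff.1
    ((hinv.and (hO.eventually_mem hx)).and (e.open_source.eventually_mem hxe))
  let T : Set E := e.target ∩ e.symm ⁻¹' O₁
  have hTo : IsOpen T := e.isOpen_inter_preimage_symm hO₁o
  have hzT : Φ x ∈ T := ⟨e.map_source hxe, by
    change e.symm (e x) ∈ O₁
    rwa [e.left_inv hxe]⟩
  have hû : ∀ z ∈ T, ContDiffAt ℝ ∞ (u ∘ e.symm) z := by
    intro z hz
    obtain ⟨⟨⟨A, hA⟩, h2⟩, -⟩ := hO₁ _ hz.2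
    have hΦz : ContDiffAt ℝ ∞ Φ (e.symm z) := hΦ.contDiffAt (hO.mem_nhds h2)
    refine (hu.contDiffAt (hO.mem_nhds h2)).comp z (e.contDiffAt_symm hz.1 (f₀' := A) ?_ hΦz)
    rw [hA]
    exact (hΦz.differentiableAt (by simp)).hasFDerivAt
  -- Cut the straightened function off, to have it on the whole space.
  obtain ⟨r, hr, hrT⟩ := Metric.isOpen_iff.1 hTo _ hzT
  let χ : ContDiffBump (Φ x) := ⟨r / 4, r / 2, by positivity, by linarith⟩
  have hũ : ContDiff ℝ ∞ fun z ↦ χ z * (u ∘ e.symm) z := by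
    rw [contDiff_iff_contDiffAt]
    intro z
    by_cases hz : z ∈ T
    · exact χ.contDiff.contDiffAt.mul (hû z hz)
    · have hz' : z ∉ tsupport χ := by
        rw [χ.tsupport_eq]
        intro h
        refine hz (hrT ?_)
        have h : dist z (Φ x) ≤ r / 2 := h
        exact Metric.mem_ball.2 (by linarith)
      refine (contDiffAt_const (c := (0 : ℝ))).congr_of_eventuallyEq ?_
      filter_upwards [notMem_tsupport_iff_eventuallyEq.1 hz'] with y hy
      simp [hy]
  obtain ⟨w, hw, hwu⟩ := exists_sub_eq_mul_of_contDiff hũ ℓ v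
  have hΦc : ContinuousAt Φ x := (hΦ.contDiffAt (hO.mem_nhds hx)).continuousAt
  have hproj : Φ x - ℓ (Φ x) • v = Φ x := by simp [hℓΦ, hx0]
  have hone : ∀ᶠ z in 𝓝 (Φ x), χ z = 1 ∧ z ∈ T :=
    χ.eventuallyEq_one.and (hTo.eventually_mem hzT)
  have hone' : ∀ᶠ z in 𝓝 (Φ x), χ (z - ℓ z • v) = 1 ∧ z - ℓ z • v ∈ T := by
    have hc : ContinuousAt (fun z ↦ z - ℓ z • v) (Φ x) := by fun_prop
    refine Filter.Tendsto.eventually (p := fun z ↦ χ z = 1 ∧ z ∈ T) hc ?_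
    change ∀ᶠ z in 𝓝 (Φ x - ℓ (Φ x) • v), _
    rwa [hproj]
  obtain ⟨O₂, hO₂, hO₂o, hxO₂⟩ := eventually_nhds_iff.1
    ((hO₁o.eventually_mem hxO₁).and (hΦc.eventually (hone.and hone')))
  refine ⟨O₂, w ∘ Φ, hO₂o, hxO₂, fun y hy ↦ (hO₁ _ (hO₂ y hy).1).1.2, ?_, ?_⟩
  · exact hw.comp_contDiffOn (hΦ.mono fun y hy ↦ (hO₁ _ (hO₂ y hy).1).1.2)
  · intro y hy
    obtain ⟨h1, ⟨h2, h3⟩, h4, h5⟩ := hO₂ y hy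
    have h6 := hwu (Φ y)
    have h7 : e.symm (Φ y) = y := e.left_inv (hO₁ _ h1).2
    have h8 : τ (e.symm (Φ y - ℓ (Φ y) • v)) = 0 := by
      rw [← hℓΦ, ← heΦ, e.right_inv h5.1]
      simp [hv]
    have h9 : u (e.symm (Φ y - ℓ (Φ y) • v)) = 0 := h0 _ (hO₁ _ h5.2).1.2 h8
    rw [Function.comp_apply, Function.comp_apply, h2, h4, h7, h9, hℓΦ] at h6
    simpa using h6

end Hadamard

/-! ### Smooth functions and fields on the manifold -/

variable {m : ℕ} {M : Type*} [TopologicalSpace M]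
  [ChartedSpace (EuclideanSpace ℝ (Fin m)) M] [IsManifold (𝓡 m) ∞ M]

/-- The vector field `X` is differentiable at `p`. -/
abbrev IsDiffFieldAt (X : Π p : M, TangentSpace (𝓡 m) p) (p : M) : Prop :=
  MDifferentiableAt (𝓡 m) (𝓡 m).tangent
    (fun q ↦ (Bundle.TotalSpace.mk' (EuclideanSpace ℝ (Fin m)) q (X q) :
      TangentBundle (𝓡 m) M)) p

theorem IsSmoothFieldOn.isDiffFieldAt {X : Π p : M, TangentSpace (𝓡 m) p} {U : Set M}
    (hX : IsSmoothFieldOn X U) (hU : IsOpen U) {p : M} (hp : p ∈ U) : IsDiffFieldAt X p :=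
  (ContMDiffOn.contMDiffAt hX (hU.mem_nhds hp)).mdifferentiableAt (by simp)

theorem IsSmoothFieldOn.mono {X : Π p : M, TangentSpace (𝓡 m) p} {U V : Set M}
    (hX : IsSmoothFieldOn X U) (h : V ⊆ U) : IsSmoothFieldOn X V :=
  ContMDiffOn.mono hX h

theorem contMDiffOn_mvfderiv_apply {f : M → ℝ} {X : Π p : M, TangentSpace (𝓡 m) p} {U : Set M}
    (hf : ContMDiffOn (𝓡 m) 𝓘(ℝ, ℝ) ∞ f U) (hX : IsSmoothFieldOn X U) (hU : IsOpen U) :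
    ContMDiffOn (𝓡 m) 𝓘(ℝ, ℝ) ∞ (fun q ↦ mvfderiv (𝓡 m) f q (X q)) U := by
  intro p hp
  have hfp : ContMDiffAt (𝓡 m) 𝓘(ℝ, ℝ) ∞ f p := hf.contMDiffAt (hU.mem_nhds hp)
  have hXp := ContMDiffOn.contMDiffAt hX (hU.mem_nhds hp)
  have h1 := hfp.mfderiv_const (m := ∞) (by simp)
  have h2 := ContMDiffAt.clm_apply_of_inCoordinates (ϕ := fun q ↦ mfderiv (𝓡 m) 𝓘(ℝ, ℝ) f q)
    (v := X) (b₁ := id) (b₂ := f) h1 hXp hfp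
  exact ((contMDiff_snd_tangentBundle_modelSpace ℝ 𝓘(ℝ, ℝ)).contMDiffAt.comp p
    h2).contMDiffWithinAt

namespace MetricTensor

variable (g : MetricTensor m M)

theorem contMDiffOn_val {X Y : Π p : M, TangentSpace (𝓡 m) p} {U : Set M}
    (hX : IsSmoothFieldOn X U) (hY : IsSmoothFieldOn Y U) :
    ContMDiffOn (𝓡 m) 𝓘(ℝ, ℝ) ∞ (fun q ↦ g.val q (X q) (Y q)) U := by
  intro p hp
  have h := ContMDiffWithinAt.clm_bundle_apply₂ (F₁ := EuclideanSpace ℝ (Fin m))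
    (F₂ := EuclideanSpace ℝ (Fin m)) (F₃ := ℝ) (E₃ := Bundle.Trivial M ℝ) (b := id)
    (ψ := g.val) (v := X) (w := Y) (s := U) (x := p) (n := ∞)
    (g.contMDiff.contMDiffAt.contMDiffWithinAt) (hX p hp) (hY p hp)
  simp only [Bundle.contMDiffWithinAt_totalSpace] at h
  exact h.2

theorem mdifferentiableAt_val {X Y : Π p : M, TangentSpace (𝓡 m) p} {p : M}
    (hX : IsDiffFieldAt X p) (hY : IsDiffFieldAt Y p) :
    MDifferentiableAt (𝓡 m) 𝓘(ℝ, ℝ) (fun q ↦ g.val q (X q) (Y q)) p := by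
  have h := MDifferentiableAt.clm_bundle_apply₂ (F₁ := EuclideanSpace ℝ (Fin m))
    (F₂ := EuclideanSpace ℝ (Fin m)) (F₃ := ℝ) (E₃ := Bundle.Trivial M ℝ) (b := id)
    (ψ := g.val) (v := X) (w := Y) (x := p)
    (g.contMDiff.contMDiffAt.mdifferentiableAt (by simp)) hX hY
  simp only [mdifferentiableAt_totalSpace] at h
  exact h.2

end MetricTensor
section Extension

variable [T2Space M]

variable (m) in
/-- A smooth bump function: it is `1` near `p` and its closed support lies in `V`. -/
theorem exists_bump {p : M} {V : Set M} (hV : IsOpen V) (hp : p ∈ V) :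
    ∃ χ : M → ℝ, ContMDiff (𝓡 m) 𝓘(ℝ, ℝ) ∞ χ ∧ (∀ᶠ q in 𝓝 p, χ q = 1) ∧ tsupport χ ⊆ V := by
  obtain ⟨χ, -, hχ⟩ := (SmoothBumpFunction.nhds_basis_tsupport (I := 𝓡 m) p).mem_iff.1
    (hV.mem_nhds hp)
  exact ⟨χ, χ.contMDiff, χ.eventuallyEq_one, hχ⟩

/-- A smooth function on an open set agrees, near a given point, with one on the whole of `M`. -/
theorem exists_contMDiff_eventuallyEq {p : M} {V : Set M} (hV : IsOpen V) (hp : p ∈ V) {f : M → ℝ}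
    (hf : ContMDiffOn (𝓡 m) 𝓘(ℝ, ℝ) ∞ f V) :
    ∃ f' : M → ℝ, ContMDiff (𝓡 m) 𝓘(ℝ, ℝ) ∞ f' ∧ ∀ᶠ q in 𝓝 p, f' q = f q := by
  obtain ⟨χ, hχ, h1, hs⟩ := exists_bump m hV hp
  refine ⟨fun q ↦ χ q * f q, contMDiff_of_tsupport fun q hq ↦ ?_, h1.mono fun q hq ↦ by simp [hq]⟩
  exact hχ.contMDiffAt.mul
    (hf.contMDiffAt (hV.mem_nhds (hs (tsupport_mul_subset_left hq))))

/-- A smooth field on an open set agrees, near a given point, with one on the whole of `M`. The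
extension is pointwise a multiple of the given field, so it stays tangent to `Σ` if that one is. -/
theorem exists_field_eventuallyEq {p : M} {V : Set M} (hV : IsOpen V) (hp : p ∈ V)
    {X : Π p : M, TangentSpace (𝓡 m) p} (hX : IsSmoothFieldOn X V) :
    ∃ X' : Π p : M, TangentSpace (𝓡 m) p, IsSmoothFieldOn X' Set.univ ∧
      (∀ᶠ q in 𝓝 p, X' q = X q) ∧ ∀ q, X' q = 0 ∨ q ∈ V ∧ ∃ c : ℝ, X' q = c • X q := by
  obtain ⟨χ, hχ, h1, hs⟩ := exists_bump m hV hp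
  refine ⟨χ • X, (ContMDiffOn.smul_section_of_tsupport hχ.contMDiffOn hV hs hX).contMDiffOn,
    h1.mono fun q hq ↦ by simp [hq], fun q ↦ ?_⟩
  by_cases hq : q ∈ V
  · exact .inr ⟨hq, χ q, rfl⟩
  · left
    simp [image_eq_zero_of_notMem_tsupport fun h ↦ hq (hs h)]

end Extension

/-! ### The dual connection -/

omit [IsManifold (𝓡 m) ∞ M] in
theorem mvfderiv_congr {f f' : M → ℝ} {p : M} (h : ∀ᶠ q in 𝓝 p, f q = f' q) :
    mvfderiv (𝓡 m) f p = mvfderiv (𝓡 m) f' p := by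
  have h' : f =ᶠ[𝓝 p] f' := h
  ext v
  have := h'.mfderiv_eq (I := 𝓡 m) (I' := 𝓘(ℝ, ℝ))
  simp only [mvfderiv, ContinuousLinearMap.comp_apply]
  have h3 := congrArg (fun L : EuclideanSpace ℝ (Fin m) →L[ℝ] ℝ ↦ L v) this
  exact h3

omit [IsManifold (𝓡 m) ∞ M] in
theorem mvfderiv_mul_apply {f f' : M → ℝ} {p : M} (hf : MDifferentiableAt (𝓡 m) 𝓘(ℝ, ℝ) f p)
    (hf' : MDifferentiableAt (𝓡 m) 𝓘(ℝ, ℝ) f' p) (v : TangentSpace (𝓡 m) p) :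
    mvfderiv (𝓡 m) (fun q ↦ f q * f' q) p v =
      f p * mvfderiv (𝓡 m) f' p v + f' p * mvfderiv (𝓡 m) f p v := by
  rw [mvfderiv_fun_mul hf hf']
  simp

omit [IsManifold (𝓡 m) ∞ M] in
theorem mvfderiv_add_apply {f f' : M → ℝ} {p : M} (hf : MDifferentiableAt (𝓡 m) 𝓘(ℝ, ℝ) f p)
    (hf' : MDifferentiableAt (𝓡 m) 𝓘(ℝ, ℝ) f' p) (v : TangentSpace (𝓡 m) p) :
    mvfderiv (𝓡 m) (fun q ↦ f q + f' q) p v =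
      mvfderiv (𝓡 m) f p v + mvfderiv (𝓡 m) f' p v := by
  rw [mvfderiv_fun_add hf hf']
  simp

omit [IsManifold (𝓡 m) ∞ M] in
theorem mdifferentiableAt_exp {f : M → ℝ} {p : M} (hf : MDifferentiableAt (𝓡 m) 𝓘(ℝ, ℝ) f p) :
    MDifferentiableAt (𝓡 m) 𝓘(ℝ, ℝ) (fun q ↦ Real.exp (2 * f q)) p :=
  MDifferentiableAt.comp (g := fun t : ℝ ↦ Real.exp (2 * t)) p
    (by fun_prop : DifferentiableAt ℝ (fun t : ℝ ↦ Real.exp (2 * t)) (f p)).mdifferentiableAt hf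

omit [IsManifold (𝓡 m) ∞ M] in
theorem mvfderiv_exp_apply {f : M → ℝ} {p : M} (hf : MDifferentiableAt (𝓡 m) 𝓘(ℝ, ℝ) f p)
    (v : TangentSpace (𝓡 m) p) :
    mvfderiv (𝓡 m) (fun q ↦ Real.exp (2 * f q)) p v =
      Real.exp (2 * f p) * (2 * mvfderiv (𝓡 m) f p v) := by
  have h1 : HasFDerivAt (fun t : ℝ ↦ Real.exp (2 * t))
      (ContinuousLinearMap.toSpanSingleton ℝ (Real.exp (2 * f p) * 2)) (f p) := by
    have := ((hasDerivAt_id (f p)).const_mul 2).exp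
    simpa using this.hasFDerivAt
  have h := (h1.hasMFDerivAt.comp p hf.hasMFDerivAt).mfderiv
  have h3 := congrArg (fun L : EuclideanSpace ℝ (Fin m) →L[ℝ] ℝ ↦ L v) h
  refine h3.trans ?_
  change (mvfderiv (𝓡 m) f p v) * (Real.exp (2 * f p) * 2) = _
  ring

namespace MetricTensor

variable (g : MetricTensor m M)

theorem dualConn_congr {X X' Y Y' Z Z' : Π p : M, TangentSpace (𝓡 m) p} {p : M}
    (hX : ∀ᶠ q in 𝓝 p, X q = X' q) (hY : ∀ᶠ q in 𝓝 p, Y q = Y' q)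
    (hZ : ∀ᶠ q in 𝓝 p, Z q = Z' q) : g.dualConn X Y Z p = g.dualConn X' Y' Z' p := by
  have h1 : mvfderiv (𝓡 m) (fun q ↦ g.val q (Y q) (Z q)) p
      = mvfderiv (𝓡 m) (fun q ↦ g.val q (Y' q) (Z' q)) p :=
    mvfderiv_congr (by filter_upwards [hY, hZ] with q h h'; rw [h, h'])
  have h2 : mvfderiv (𝓡 m) (fun q ↦ g.val q (X q) (Z q)) p
      = mvfderiv (𝓡 m) (fun q ↦ g.val q (X' q) (Z' q)) p :=
    mvfderiv_congr (by filter_upwards [hX, hZ] with q h h'; rw [h, h'])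
  have h3 : mvfderiv (𝓡 m) (fun q ↦ g.val q (X q) (Y q)) p
      = mvfderiv (𝓡 m) (fun q ↦ g.val q (X' q) (Y' q)) p :=
    mvfderiv_congr (by filter_upwards [hX, hY] with q h h'; rw [h, h'])
  have h4 : VectorField.mlieBracket (𝓡 m) X Y p = VectorField.mlieBracket (𝓡 m) X' Y' p :=
    Filter.EventuallyEq.mlieBracket_vectorField_eq hX hY
  have h5 : VectorField.mlieBracket (𝓡 m) X Z p = VectorField.mlieBracket (𝓡 m) X' Z' p :=
    Filter.EventuallyEq.mlieBracket_vectorField_eq hX hZ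
  have h6 : VectorField.mlieBracket (𝓡 m) Y Z p = VectorField.mlieBracket (𝓡 m) Y' Z' p :=
    Filter.EventuallyEq.mlieBracket_vectorField_eq hY hZ
  unfold dualConn
  rw [h1, h2, h3, h4, h5, h6, hX.self_of_nhds, hY.self_of_nhds, hZ.self_of_nhds]

/-- Metric compatibility of the dual connection: `□_X Y (Y) = X(g(Y, Y)) / 2`. -/
theorem dualConn_self (X Y : Π p : M, TangentSpace (𝓡 m) p) (p : M) :
    g.dualConn X Y Y p = 1 / 2 * mvfderiv (𝓡 m) (fun q ↦ g.val q (Y q) (Y q)) p (X p) := by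
  simp [dualConn]

/-- The change of the dual connection under a conformal change of the tensor. -/
theorem dualConn_conformal {g' : MetricTensor m M} {f : M → ℝ} {p : M}
    (hg : ∀ (p : M) (v w : TangentSpace (𝓡 m) p),
      g'.val p v w = Real.exp (2 * f p) * g.val p v w)
    (hf : MDifferentiableAt (𝓡 m) 𝓘(ℝ, ℝ) f p) {X Y Z : Π p : M, TangentSpace (𝓡 m) p}
    (hX : IsDiffFieldAt X p) (hY : IsDiffFieldAt Y p) (hZ : IsDiffFieldAt Z p) :
    g'.dualConn X Y Z p = Real.exp (2 * f p) * (g.dualConn X Y Z p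
      + mvfderiv (𝓡 m) f p (X p) * g.val p (Y p) (Z p)
      + mvfderiv (𝓡 m) f p (Y p) * g.val p (X p) (Z p)
      - mvfderiv (𝓡 m) f p (Z p) * g.val p (X p) (Y p)) := by
  have hd : ∀ {A B C : Π p : M, TangentSpace (𝓡 m) p}, IsDiffFieldAt A p → IsDiffFieldAt B p →
      mvfderiv (𝓡 m) (fun q ↦ g'.val q (A q) (B q)) p (C p) =
        Real.exp (2 * f p) * mvfderiv (𝓡 m) (fun q ↦ g.val q (A q) (B q)) p (C p)
        + g.val p (A p) (B p) * (Real.exp (2 * f p) * (2 * mvfderiv (𝓡 m) f p (C p))) := by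
    intro A B C hA hB
    simp only [hg]
    rw [mvfderiv_mul_apply (mdifferentiableAt_exp hf) (g.mdifferentiableAt_val hA hB),
      mvfderiv_exp_apply hf]
  unfold dualConn
  rw [hd hY hZ, hd hX hZ, hd hX hY, hg, hg, hg]
  ring

/-- The dual connection is tensorial in its last argument. -/
theorem tensorialAt_dualConn {X Y : Π p : M, TangentSpace (𝓡 m) p} {p : M}
    (hX : IsDiffFieldAt X p) (hY : IsDiffFieldAt Y p) :
    TensorialAt (𝓡 m) (EuclideanSpace ℝ (Fin m)) (fun Z ↦ g.dualConn X Y Z p) p where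
  smul {φ Z} hφ hZ := by
    have h1 := VectorField.mlieBracket_smul_right (V := X) hφ hZ
    have h2 := VectorField.mlieBracket_smul_right (V := Y) hφ hZ
    have h3 := mvfderiv_mul_apply hφ (g.mdifferentiableAt_val hY hZ) (X p)
    have h4 := mvfderiv_mul_apply hφ (g.mdifferentiableAt_val hX hZ) (Y p)
    simp only [dualConn, h1, h2, Pi.smul_apply', map_smul, map_add, smul_eq_mul, h3, h4,
      add_apply, smul_apply]
    rw [g.symm p (Z p) (Y p), g.symm p (Z p) (X p)]
    ring
  add {Z Z'} hZ hZ' := by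
    have h1 := VectorField.mlieBracket_add_right (V := X) hZ hZ'
    have h2 := VectorField.mlieBracket_add_right (V := Y) hZ hZ'
    have h3 := mvfderiv_add_apply (g.mdifferentiableAt_val hY hZ)
      (g.mdifferentiableAt_val hY hZ') (X p)
    have h4 := mvfderiv_add_apply (g.mdifferentiableAt_val hX hZ)
      (g.mdifferentiableAt_val hX hZ') (Y p)
    simp only [dualConn, h1, h2, Pi.add_apply, map_add, h3, h4, add_apply]
    ring

/-- Scaling of the dual connection in its last argument, at a single point. -/
theorem dualConn_of_eq_smul {X Y Z Z' : Π p : M, TangentSpace (𝓡 m) p} {p : M}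
    (hX : IsDiffFieldAt X p) (hY : IsDiffFieldAt Y p) (hZ : IsDiffFieldAt Z p)
    (hZ' : IsDiffFieldAt Z' p) {c : ℝ} (h : Z' p = c • Z p) :
    g.dualConn X Y Z' p = c * g.dualConn X Y Z p := by
  have ht := g.tensorialAt_dualConn hX hY
  have hc : MDifferentiableAt (𝓡 m) 𝓘(ℝ, ℝ) (fun _ : M ↦ c) p := mdifferentiableAt_const
  have h1 := ht.smul hc hZ
  rw [← smul_eq_mul, ← h1]
  exact ht.pointwise hZ' (hc.smul_section hZ) h

/-- If `B` is radical at `p`, then the differential of `g(A, B)` at `p` is tensorial in `A`. -/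
theorem tensorialAt_mvfderiv_val {B : Π p : M, TangentSpace (𝓡 m) p} {p : M}
    (hB : IsDiffFieldAt B p) (hr : B p ∈ g.radical p) :
    TensorialAt (𝓡 m) (EuclideanSpace ℝ (Fin m))
      (fun A ↦ (mvfderiv (𝓡 m) (fun q ↦ g.val q (A q) (B q)) p :
        TangentSpace (𝓡 m) p →L[ℝ] ℝ)) p where
  smul {φ A} hφ hA := by
    ext v
    have h0 : g.val p (A p) (B p) = 0 := by rw [g.symm]; exact hr _
    have h1 := mvfderiv_mul_apply hφ (g.mdifferentiableAt_val hA hB) v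
    simp only [Pi.smul_apply', map_smul, smul_apply, smul_eq_mul, h1, h0]
    ring
  add {A A'} hA hA' := by
    ext v
    have h1 := mvfderiv_add_apply (g.mdifferentiableAt_val hA hB)
      (g.mdifferentiableAt_val hA' hB) v
    simp only [Pi.add_apply, map_add, add_apply, h1]

theorem mvfderiv_val_of_eq_smul {A A' B : Π p : M, TangentSpace (𝓡 m) p} {p : M}
    (hA : IsDiffFieldAt A p) (hA' : IsDiffFieldAt A' p) (hB : IsDiffFieldAt B p)
    (hr : B p ∈ g.radical p) {a : ℝ} (h : A' p = a • A p) (v : TangentSpace (𝓡 m) p) :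
    mvfderiv (𝓡 m) (fun q ↦ g.val q (A' q) (B q)) p v =
      a * mvfderiv (𝓡 m) (fun q ↦ g.val q (A q) (B q)) p v := by
  have ht := g.tensorialAt_mvfderiv_val hB hr
  have hc : MDifferentiableAt (𝓡 m) 𝓘(ℝ, ℝ) (fun _ : M ↦ a) p := mdifferentiableAt_const
  have h1 := ht.smul hc hA
  have h2 := ht.pointwise hA' (hc.smul_section hA) h
  exact congrArg (fun L : TangentSpace (𝓡 m) p →L[ℝ] ℝ ↦ L v) (h2.trans h1)

/-- If `A` and `B` are multiples of the radical vector `R` at `p`, then the differential of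
`g(A, B)` at `p` is a multiple of that of `g(R, R)`. -/
theorem mvfderiv_val_of_eq_smul₂ {A B R : Π p : M, TangentSpace (𝓡 m) p} {p : M}
    (hA : IsDiffFieldAt A p) (hB : IsDiffFieldAt B p) (hR : IsDiffFieldAt R p)
    (hr : R p ∈ g.radical p) {a b : ℝ} (ha : A p = a • R p) (hb : B p = b • R p)
    (v : TangentSpace (𝓡 m) p) :
    mvfderiv (𝓡 m) (fun q ↦ g.val q (A q) (B q)) p v =
      a * b * mvfderiv (𝓡 m) (fun q ↦ g.val q (R q) (R q)) p v := by
  have hrB : B p ∈ g.radical p := fun w ↦ by rw [hb, map_smul]; simp [hr w]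
  rw [g.mvfderiv_val_of_eq_smul hR hA hB hrB ha]
  have hs : (fun q ↦ g.val q (R q) (B q)) = fun q ↦ g.val q (B q) (R q) :=
    funext fun q ↦ g.symm _ _ _
  rw [hs, g.mvfderiv_val_of_eq_smul hR hB hR hr hb, mul_assoc]

end MetricTensor

/-! ### Gram determinants and radicals -/

section SmoothDet

omit [IsManifold (𝓡 m) ∞ M] in
theorem contMDiffOn_det {n : ℕ} {A : M → Matrix (Fin n) (Fin n) ℝ} {U : Set M}
    (hA : ∀ i j, ContMDiffOn (𝓡 m) 𝓘(ℝ, ℝ) ∞ (fun q ↦ A q i j) U) :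
    ContMDiffOn (𝓡 m) 𝓘(ℝ, ℝ) ∞ (fun q ↦ (A q).det) U := by
  simp only [Matrix.det_apply']
  exact contMDiffOn_finsetSum fun σ _ ↦
    contMDiffOn_const.mul (contMDiffOn_finsetProd fun i _ ↦ hA _ _)

omit [IsManifold (𝓡 m) ∞ M] in
theorem contMDiffOn_adjugate {n : ℕ} {A : M → Matrix (Fin n) (Fin n) ℝ} {U : Set M}
    (hA : ∀ i j, ContMDiffOn (𝓡 m) 𝓘(ℝ, ℝ) ∞ (fun q ↦ A q i j) U) (i j : Fin n) :
    ContMDiffOn (𝓡 m) 𝓘(ℝ, ℝ) ∞ (fun q ↦ (A q).adjugate i j) U := by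
  simp only [Matrix.adjugate_apply]
  refine contMDiffOn_det fun k l ↦ ?_
  by_cases h : k = j
  · subst h
    simpa using contMDiffOn_const
  · simpa [Matrix.updateRow_ne h] using hA k l

end SmoothDet

section CoordFrame

variable (m) in
/-- The domain of the coordinate frame `coordField p`. -/
def frameDomain (p : M) : Set M :=
  (trivializationAt (EuclideanSpace ℝ (Fin m)) (TangentSpace (𝓡 m)) p).baseSet

theorem isOpen_frameDomain (p : M) : IsOpen (frameDomain m p) :=
  (trivializationAt (EuclideanSpace ℝ (Fin m)) (TangentSpace (𝓡 m)) p).open_baseSet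

theorem mem_frameDomain (p : M) : p ∈ frameDomain m p :=
  FiberBundle.mem_baseSet_trivializationAt' p

theorem isSmoothFieldOn_coordField (p : M) (a : Fin m) :
    IsSmoothFieldOn (coordField m p a) (frameDomain m p) :=
  Bundle.Trivialization.contMDiffOn_localFrame_baseSet ∞ _ _ a

theorem isSmoothFieldOn_sum {p : M} {U : Set M} (hU : U ⊆ frameDomain m p) {c : Fin m → M → ℝ}
    (hc : ∀ a, ContMDiffOn (𝓡 m) 𝓘(ℝ, ℝ) ∞ (c a) U) :
    IsSmoothFieldOn (fun q ↦ ∑ a, c a q • coordField m p a q) U :=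
  ContMDiffOn.sum_section fun a _ ↦
    (hc a).smul_section ((isSmoothFieldOn_coordField p a).mono hU)

/-- The basis of the tangent space at `q` that consists of the coordinate vectors. -/
def coordBasis (p : M) {q : M} (hq : q ∈ frameDomain m p) :
    Module.Basis (Fin m) ℝ (TangentSpace (𝓡 m) q) :=
  (trivializationAt (EuclideanSpace ℝ (Fin m)) (TangentSpace (𝓡 m)) p).basisAt
    (EuclideanSpace.basisFun (Fin m) ℝ).toBasis hq

theorem coordBasis_apply (p : M) {q : M} (hq : q ∈ frameDomain m p) (a : Fin m) :
    coordBasis p hq a = coordField m p a q :=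
  (Bundle.Trivialization.localFrame_apply_of_mem_baseSet _ _ hq).symm

theorem exists_coord (p : M) {q : M} (hq : q ∈ frameDomain m p) (v : TangentSpace (𝓡 m) q) :
    ∃ c : Fin m → ℝ, v = ∑ a, c a • coordField m p a q := by
  refine ⟨(coordBasis p hq).repr v, ?_⟩
  simp only [← coordBasis_apply p hq]
  exact ((coordBasis p hq).sum_repr v).symm

theorem coord_eq_zero (p : M) {q : M} (hq : q ∈ frameDomain m p) {c : Fin m → ℝ}
    (h : ∑ a, c a • coordField m p a q = 0) : c = 0 := by
  simp only [← coordBasis_apply p hq] at h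
  exact funext fun a ↦ Fintype.linearIndependent_iff.1 (coordBasis p hq).linearIndependent c h a

variable (m) in
/-- Every tangent vector extends to a smooth vector field near its base point. -/
theorem exists_field_apply_eq (p : M) (v : TangentSpace (𝓡 m) p) :
    ∃ X : Π q : M, TangentSpace (𝓡 m) q, IsSmoothFieldOn X (frameDomain m p) ∧ X p = v := by
  obtain ⟨c, hc⟩ := exists_coord p (mem_frameDomain p) v
  exact ⟨_, isSmoothFieldOn_sum (c := fun a _ ↦ c a) subset_rfl fun a ↦ contMDiffOn_const,
    hc.symm⟩

end CoordFrame

namespace MetricTensor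

variable (g : MetricTensor m M)

/-- The Gram matrix of `g` at `q` in the preferred coordinates at `p`. -/
def gramMatrix (p q : M) : Matrix (Fin m) (Fin m) ℝ :=
  Matrix.of fun a b ↦ g.val q (coordField m p a q) (coordField m p b q)

theorem gramDet_eq (p q : M) : g.gramDet p q = (g.gramMatrix p q).det := rfl

theorem gramMatrix_apply (p q : M) (a b : Fin m) :
    g.gramMatrix p q a b = g.val q (coordField m p a q) (coordField m p b q) := rfl

theorem contMDiffOn_gramMatrix (p : M) (a b : Fin m) :
    ContMDiffOn (𝓡 m) 𝓘(ℝ, ℝ) ∞ (fun q ↦ g.gramMatrix p q a b) (frameDomain m p) :=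
  g.contMDiffOn_val (isSmoothFieldOn_coordField p a) (isSmoothFieldOn_coordField p b)

theorem contMDiffOn_gramDet (p : M) :
    ContMDiffOn (𝓡 m) 𝓘(ℝ, ℝ) ∞ (g.gramDet p) (frameDomain m p) :=
  contMDiffOn_det (g.contMDiffOn_gramMatrix p)

theorem mdifferentiableAt_gramDet (p : M) :
    MDifferentiableAt (𝓡 m) 𝓘(ℝ, ℝ) (g.gramDet p) p :=
  ((g.contMDiffOn_gramDet p).contMDiffAt
    ((isOpen_frameDomain p).mem_nhds (mem_frameDomain p))).mdifferentiableAt (by simp)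

theorem val_sum_sum (p q : M) (c d : Fin m → ℝ) :
    g.val q (∑ a, c a • coordField m p a q) (∑ b, d b • coordField m p b q) =
      c ⬝ᵥ (g.gramMatrix p q).mulVec d := by
  simp only [map_sum, map_smul, sum_apply, smul_apply,
    smul_eq_mul, dotProduct, Matrix.mulVec, gramMatrix_apply, Finset.mul_sum]
  rw [Finset.sum_comm]
  exact Finset.sum_congr rfl fun a _ ↦ Finset.sum_congr rfl fun b _ ↦ by ring

/-- The vector at `q` with coordinates `adj(G) d`, where `G` is the Gram matrix in the preferred
coordinates at `p`. Where `G` is regular, it is `det G` times the vector that is `g`-dual to the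
covector with coordinates `d`. -/
def adjVec (p : M) (d : Fin m → ℝ) (q : M) : TangentSpace (𝓡 m) q :=
  ∑ b, ((g.gramMatrix p q).adjugate.mulVec d) b • coordField m p b q

theorem val_sum_adjVec (p q : M) (c d : Fin m → ℝ) :
    g.val q (∑ a, c a • coordField m p a q) (g.adjVec p d q) = g.gramDet p q * (c ⬝ᵥ d) := by
  rw [adjVec, val_sum_sum, Matrix.mulVec_mulVec, Matrix.mul_adjugate, Matrix.smul_mulVec,
    Matrix.one_mulVec, dotProduct_smul, smul_eq_mul, gramDet_eq]

theorem contMDiffOn_adjugate_mulVec (p : M) {U : Set M} (hU : U ⊆ frameDomain m p)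
    {d : M → Fin m → ℝ} (hd : ∀ a, ContMDiffOn (𝓡 m) 𝓘(ℝ, ℝ) ∞ (fun q ↦ d q a) U) (b : Fin m) :
    ContMDiffOn (𝓡 m) 𝓘(ℝ, ℝ) ∞ (fun q ↦ ((g.gramMatrix p q).adjugate.mulVec (d q)) b) U := by
  simp only [Matrix.mulVec, dotProduct]
  exact contMDiffOn_finsetSum fun a _ ↦
    ((contMDiffOn_adjugate (g.contMDiffOn_gramMatrix p) b a).mono hU).mul (hd a)

theorem isSmoothFieldOn_adjVec (p : M) {U : Set M} (hU : U ⊆ frameDomain m p)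
    {d : M → Fin m → ℝ} (hd : ∀ a, ContMDiffOn (𝓡 m) 𝓘(ℝ, ℝ) ∞ (fun q ↦ d q a) U) :
    IsSmoothFieldOn (fun q ↦ g.adjVec p (d q) q) U :=
  isSmoothFieldOn_sum hU fun b ↦ g.contMDiffOn_adjugate_mulVec p hU hd b

theorem gramDet_eq_zero_iff (p : M) {q : M} (hq : q ∈ frameDomain m p) :
    g.gramDet p q = 0 ↔ q ∈ g.sing := by
  rw [gramDet_eq, ← Matrix.exists_mulVec_eq_zero_iff]
  constructor
  · rintro ⟨c, hc, h⟩
    refine ⟨∑ a, c a • coordField m p a q, fun w ↦ ?_, fun h0 ↦ hc (coord_eq_zero p hq h0)⟩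
    obtain ⟨d, rfl⟩ := exists_coord p hq w
    rw [g.symm, val_sum_sum, h, dotProduct_zero]
  · rintro ⟨ξ, hξ, h0⟩
    obtain ⟨c, rfl⟩ := exists_coord p hq ξ
    refine ⟨c, fun h ↦ h0 (by simp [h]), funext fun a ↦ ?_⟩
    have h1 := hξ (∑ b, (Pi.single a (1 : ℝ) : Fin m → ℝ) b • coordField m p b q)
    rw [g.symm, val_sum_sum, single_one_dotProduct] at h1
    exact h1

theorem adjVec_mem_radical (p : M) {q : M} (hq : q ∈ frameDomain m p) (hs : q ∈ g.sing)
    (d : Fin m → ℝ) : g.adjVec p d q ∈ g.radical q := by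
  intro w
  obtain ⟨c, rfl⟩ := exists_coord p hq w
  rw [g.symm, val_sum_adjVec, (g.gramDet_eq_zero_iff p hq).2 hs, zero_mul]

theorem add_mem_radical {p : M} {ξ η : TangentSpace (𝓡 m) p} (hξ : ξ ∈ g.radical p)
    (hη : η ∈ g.radical p) : ξ + η ∈ g.radical p := fun w ↦ by simp [hξ w, hη w]

theorem smul_mem_radical {p : M} {ξ : TangentSpace (𝓡 m) p} (hξ : ξ ∈ g.radical p) (c : ℝ) :
    c • ξ ∈ g.radical p := fun w ↦ by simp [hξ w]

variable {g}

theorem HasTransverseRadical.dGramDet_radical_ne_zero (ht : g.HasTransverseRadical) {p : M}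
    (hp : p ∈ g.sing) {ξ : TangentSpace (𝓡 m) p} (hξ : ξ ∈ g.radical p) (h0 : ξ ≠ 0) :
    g.dGramDet p ξ ≠ 0 := ht p hp ξ hξ h0

/-- A transverse radical is one-dimensional. -/
theorem HasTransverseRadical.exists_eq_smul (ht : g.HasTransverseRadical) {p : M}
    (hp : p ∈ g.sing) {ξ η : TangentSpace (𝓡 m) p} (hξ : ξ ∈ g.radical p) (h0 : ξ ≠ 0)
    (hη : η ∈ g.radical p) : ∃ c : ℝ, η = c • ξ := by
  have h1 := ht.dGramDet_radical_ne_zero hp hξ h0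
  refine ⟨g.dGramDet p η / g.dGramDet p ξ, ?_⟩
  by_contra hne
  have h2 := g.add_mem_radical hη (g.smul_mem_radical hξ (-(g.dGramDet p η / g.dGramDet p ξ)))
  refine ht p hp _ h2 (fun h ↦ hne ?_) ?_
  · rw [neg_smul, ← sub_eq_add_neg] at h
    exact sub_eq_zero.1 h
  · change g.dGramDet p _ = 0
    rw [map_add, map_smul, smul_eq_mul]
    field_simp
    ring

/-- For a radical `R` the function `g(R, R)` has, at singular points, the same differential as the
determinant of `g`, up to a nonzero factor: differentiate `g(R, adj(G) R) = det G |R|²`, where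
`adj(G) R` is again radical. -/
theorem exists_mvfderiv_val_eq (ht : g.HasTransverseRadical) {p : M} (hp : p ∈ g.sing)
    (hd : g.dGramDet p ≠ 0) {R : Π p : M, TangentSpace (𝓡 m) p} (hR : IsDiffFieldAt R p)
    (hr : R p ∈ g.radical p) (h0 : R p ≠ 0) :
    ∃ c : ℝ, c ≠ 0 ∧ ∀ v, mvfderiv (𝓡 m) (fun q ↦ g.val q (R q) (R q)) p v =
      c * g.dGramDet p v := by
  have hU := mem_frameDomain (m := m) p
  obtain ⟨r, hr'⟩ := exists_coord p hU (R p)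
  let T : Π q : M, TangentSpace (𝓡 m) q := fun q ↦ ∑ a, r a • coordField m p a q
  have hT : IsDiffFieldAt T p :=
    (isSmoothFieldOn_sum (c := fun a _ ↦ r a) subset_rfl fun a ↦
      contMDiffOn_const).isDiffFieldAt (isOpen_frameDomain p) hU
  have hS : IsDiffFieldAt (g.adjVec p r) p :=
    (g.isSmoothFieldOn_adjVec p subset_rfl (d := fun _ ↦ r) fun a ↦
      contMDiffOn_const).isDiffFieldAt (isOpen_frameDomain p) hU
  obtain ⟨μ, hμ⟩ := ht.exists_eq_smul hp hr h0 (g.adjVec_mem_radical p hU hp r)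
  have h1 := g.mvfderiv_val_of_eq_smul₂ hT hS hR hr (a := 1) (by rw [one_smul, hr']) hμ
  have hrr : r ⬝ᵥ r ≠ 0 := by
    intro h
    rw [dotProduct_self_eq_zero] at h
    exact h0 (by simp [hr', h])
  have h2 : ∀ v, mvfderiv (𝓡 m) (fun q ↦ g.val q (T q) (g.adjVec p r q)) p v =
      (r ⬝ᵥ r) * g.dGramDet p v := by
    intro v
    have h3 : (fun q ↦ g.val q (T q) (g.adjVec p r q)) = fun q ↦ (r ⬝ᵥ r) * g.gramDet p q := by
      funext q
      rw [g.val_sum_adjVec, mul_comm]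
    rw [h3, mvfderiv_mul_apply mdifferentiableAt_const (g.mdifferentiableAt_gramDet p),
      mvfderiv_const]
    simp [dGramDet]
  -- `adj(G) r` is nonzero at `p`, since otherwise the differential of `det G` would vanish.
  have hμ0 : μ ≠ 0 := by
    rintro rfl
    obtain ⟨v, hv⟩ := DFunLike.ne_iff.1 hd
    have h4 := h2 v
    rw [h1 v, mul_zero, zero_mul] at h4
    exact (mul_ne_zero hrr hv) h4.symm
  refine ⟨μ⁻¹ * (r ⬝ᵥ r), mul_ne_zero (inv_ne_zero hμ0) hrr, fun v ↦ ?_⟩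
  rw [mul_assoc, ← h2 v, h1 v, one_mul, inv_mul_cancel_left₀ hμ0]

end MetricTensor

/-! ### Conformal changes and fields tangent to the singular set -/

namespace MetricTensor

/-- The hypotheses on a transverse Riemann-Lorentz tensor with transverse radical that do not
mention the index: the determinant of `g` has nonzero differential along `Σ`, and the radicals are
transverse to `Σ`. -/
structure HasRegularSing (g : MetricTensor m M) : Prop where
  dGramDet_ne_zero : ∀ p ∈ g.sing, g.dGramDet p ≠ 0
  transverse : g.HasTransverseRadical

/-- The tensor `g'` is `e^{2f} g`. -/
def IsConformalChange (f : M → ℝ) (g g' : MetricTensor m M) : Prop :=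
  ∀ (p : M) (v w : TangentSpace (𝓡 m) p), g'.val p v w = Real.exp (2 * f p) * g.val p v w

section Conformal

variable {f : M → ℝ} {g g' : MetricTensor m M}

variable (g) in
theorem exists_isConformalChange (hf : ContMDiff (𝓡 m) 𝓘(ℝ, ℝ) ∞ f) :
    ∃ g', IsConformalChange f g g' := by
  have he : ContMDiff (𝓡 m) 𝓘(ℝ, ℝ) ∞ fun q ↦ Real.exp (2 * f q) :=
    (Real.contDiff_exp.comp (contDiff_id.const_smul (2 : ℝ))).contMDiff.comp hf
  exact ⟨⟨fun p ↦ Real.exp (2 * f p) • g.val p, fun p v w ↦ by simp [g.symm p v w],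
    he.smul_section g.contMDiff⟩, fun p v w ↦ by simp⟩

theorem IsConformalChange.symm (h : IsConformalChange f g g') :
    IsConformalChange (fun p ↦ -f p) g' g := fun p v w ↦ by
  rw [h, ← mul_assoc, ← Real.exp_add]
  simp

theorem IsConformalChange.trans {f' : M → ℝ} {g'' : MetricTensor m M}
    (h : IsConformalChange f g g') (h' : IsConformalChange f' g' g'') :
    IsConformalChange (fun p ↦ f p + f' p) g g'' := fun p v w ↦ by
  rw [h', h, ← mul_assoc, ← Real.exp_add]
  ring_nf

theorem IsConformalChange.radical_eq (h : IsConformalChange f g g') (p : M) :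
    g'.radical p = g.radical p := by
  ext ξ
  exact forall_congr' fun w ↦ by rw [h]; simp [Real.exp_ne_zero]

theorem IsConformalChange.sing_eq (h : IsConformalChange f g g') : g'.sing = g.sing := by
  ext p
  simp only [sing, h.radical_eq]

theorem IsConformalChange.dGramDet_apply (h : IsConformalChange f g g')
    (hf : ContMDiff (𝓡 m) 𝓘(ℝ, ℝ) ∞ f) {p : M} (hp : p ∈ g.sing) (v : TangentSpace (𝓡 m) p) :
    g'.dGramDet p v = Real.exp (2 * f p) ^ m * g.dGramDet p v := by
  have h1 : g'.gramDet p = fun q ↦ Real.exp (2 * f q) ^ m * g.gramDet p q := by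
    funext q
    have : g'.gramMatrix p q = Real.exp (2 * f q) • g.gramMatrix p q := by
      ext a b
      exact h q _ _
    rw [gramDet_eq, this, Matrix.det_smul, Fintype.card_fin, gramDet_eq]
  have he : ContMDiff (𝓡 m) 𝓘(ℝ, ℝ) ∞ fun q ↦ Real.exp (2 * f q) ^ m :=
    ((Real.contDiff_exp.comp (contDiff_id.const_smul (2 : ℝ))).pow m).contMDiff.comp hf
  rw [dGramDet, h1, mvfderiv_mul_apply (he.contMDiffAt.mdifferentiableAt (by simp))
    (g.mdifferentiableAt_gramDet p), (g.gramDet_eq_zero_iff p (mem_frameDomain p)).2 hp,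
    zero_mul, add_zero]
  rfl

theorem IsConformalChange.singTangent_eq (h : IsConformalChange f g g')
    (hf : ContMDiff (𝓡 m) 𝓘(ℝ, ℝ) ∞ f) {p : M} (hp : p ∈ g.sing) :
    g'.singTangent p = g.singTangent p := by
  ext v
  simp [singTangent, h.dGramDet_apply hf hp, Real.exp_ne_zero]

theorem IsConformalChange.hasRegularSing (h : IsConformalChange f g g')
    (hf : ContMDiff (𝓡 m) 𝓘(ℝ, ℝ) ∞ f) (hg : g.HasRegularSing) : g'.HasRegularSing where
  dGramDet_ne_zero p hp h0 := by
    rw [h.sing_eq] at hp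
    refine hg.dGramDet_ne_zero p hp (ContinuousLinearMap.ext fun v ↦ ?_)
    have h1 := h.dGramDet_apply hf hp v
    rw [h0] at h1
    simpa [Real.exp_ne_zero] using h1.symm
  transverse p hp ξ hξ h0 := by
    rw [h.sing_eq] at hp
    rw [h.radical_eq] at hξ
    rw [h.singTangent_eq hf hp]
    exact hg.transverse p hp ξ hξ h0

theorem IsConformalChange.isRadicalFieldOn (h : IsConformalChange f g g')
    {R : Π p : M, TangentSpace (𝓡 m) p} {U : Set M} (hR : g.IsRadicalFieldOn R U) :
    g'.IsRadicalFieldOn R U := by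
  refine ⟨hR.1, fun p hp ↦ ?_⟩
  rw [h.radical_eq]
  rw [h.sing_eq] at hp
  exact hR.2 p hp

theorem IsConformalChange.isSingTangentFieldOn (h : IsConformalChange f g g')
    (hf : ContMDiff (𝓡 m) 𝓘(ℝ, ℝ) ∞ f) {X : Π p : M, TangentSpace (𝓡 m) p} {U : Set M}
    (hX : g.IsSingTangentFieldOn X U) : g'.IsSingTangentFieldOn X U := by
  refine ⟨hX.1, fun p hp ↦ ?_⟩
  rw [h.sing_eq] at hp
  rw [h.singTangent_eq hf hp.1]
  exact hX.2 p hp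

end Conformal

variable {g : MetricTensor m M}

theorem IsRadicalFieldOn.mono {R : Π p : M, TangentSpace (𝓡 m) p} {U V : Set M}
    (hR : g.IsRadicalFieldOn R U) (h : V ⊆ U) : g.IsRadicalFieldOn R V :=
  ⟨hR.1.mono h, fun p hp ↦ hR.2 p ⟨hp.1, h hp.2⟩⟩

theorem IsSingTangentFieldOn.mono {R : Π p : M, TangentSpace (𝓡 m) p} {U V : Set M}
    (hR : g.IsSingTangentFieldOn R U) (h : V ⊆ U) : g.IsSingTangentFieldOn R V :=
  ⟨hR.1.mono h, fun p hp ↦ hR.2 p ⟨hp.1, h hp.2⟩⟩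

theorem HasRegularSing.exists_mvfderiv_val_eq (hg : g.HasRegularSing)
    {R : Π p : M, TangentSpace (𝓡 m) p} {U : Set M} (hU : IsOpen U)
    (hR : g.IsRadicalFieldOn R U) {p : M} (hp : p ∈ g.sing) (hpU : p ∈ U) :
    ∃ c : ℝ, c ≠ 0 ∧ ∀ v, mvfderiv (𝓡 m) (fun q ↦ g.val q (R q) (R q)) p v =
      c * g.dGramDet p v :=
  MetricTensor.exists_mvfderiv_val_eq hg.transverse hp (hg.dGramDet_ne_zero p hp)
    (hR.1.isDiffFieldAt hU hpU) (hR.2 p ⟨hp, hpU⟩).1 (hR.2 p ⟨hp, hpU⟩).2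

theorem HasRegularSing.mvfderiv_val_radical_ne_zero (hg : g.HasRegularSing)
    {R : Π p : M, TangentSpace (𝓡 m) p} {U : Set M} (hU : IsOpen U)
    (hR : g.IsRadicalFieldOn R U) {p : M} (hp : p ∈ g.sing) (hpU : p ∈ U) :
    mvfderiv (𝓡 m) (fun q ↦ g.val q (R q) (R q)) p (R p) ≠ 0 := by
  obtain ⟨c, hc, h⟩ := hg.exists_mvfderiv_val_eq hU hR hp hpU
  rw [h]
  exact mul_ne_zero hc (hg.transverse.dGramDet_radical_ne_zero hp (hR.2 p ⟨hp, hpU⟩).1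
    (hR.2 p ⟨hp, hpU⟩).2)

/-- In dimension at least two, the restriction of `g` to the tangent space of `Σ` does not
vanish: otherwise each vector tangent to `Σ` would be radical. -/
theorem HasRegularSing.exists_singTangent_val_ne_zero (hg : g.HasRegularSing) (hm : 2 ≤ m) {p : M}
    (hp : p ∈ g.sing) : ∃ v ∈ g.singTangent p, g.val p v v ≠ 0 := by
  by_contra! h
  obtain ⟨ξ, hξ, h0⟩ := id hp
  have hξ0 := hg.transverse.dGramDet_radical_ne_zero hp hξ h0
  have hproj : ∀ w : TangentSpace (𝓡 m) p,
      w + (-(g.dGramDet p w / g.dGramDet p ξ)) • ξ ∈ g.singTangent p := by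
    intro w
    change g.dGramDet p _ = 0
    rw [map_add, map_smul, smul_eq_mul]
    field_simp
    ring
  have hpol : ∀ v ∈ g.singTangent p, ∀ w ∈ g.singTangent p, g.val p v w = 0 := by
    intro v hv w hw
    have hvw : v + w ∈ g.singTangent p := by
      change g.dGramDet p _ = 0
      rw [map_add, show g.dGramDet p v = 0 from hv, show g.dGramDet p w = 0 from hw, add_zero]
    have h1 := h _ hvw
    simp only [map_add, add_apply, h v hv, h w hw, g.symm p w v] at h1
    linarith
  have hrad : ∀ v ∈ g.singTangent p, v = 0 := by
    intro v hv
    by_contra hv0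
    refine hg.transverse p hp v (fun w ↦ ?_) hv0 hv
    have h1 := hpol v hv _ (hproj w)
    rw [map_add, map_smul, g.symm p v ξ, hξ v, smul_zero, add_zero] at h1
    exact h1
  -- Hence the tangent space of `Σ` is zero, and `ξ` alone spans that of `M`.
  have hfin : Module.finrank ℝ (TangentSpace (𝓡 m) p) ≤ 1 := by
    refine finrank_le_one ξ fun w ↦ ⟨g.dGramDet p w / g.dGramDet p ξ, ?_⟩
    have h1 := hrad _ (hproj w)
    rw [neg_smul, ← sub_eq_add_neg, sub_eq_zero] at h1
    exact h1.symm
  have : Module.finrank ℝ (TangentSpace (𝓡 m) p) = m := finrank_euclideanSpace_fin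
  omega

/-- Through each singular point there is a field tangent to `Σ` on which `g` does not vanish:
project a field along `R` to the kernel of `dρ`, where `ρ = g(R, R)`, and cut it off. -/
theorem HasRegularSing.exists_isSingTangentFieldOn [T2Space M] (hg : g.HasRegularSing)
    (hm : 2 ≤ m) {R : Π p : M, TangentSpace (𝓡 m) p} {U : Set M} (hU : IsOpen U)
    (hR : g.IsRadicalFieldOn R U) {p : M} (hp : p ∈ g.sing) (hpU : p ∈ U) :
    ∃ X, g.IsSingTangentFieldOn X Set.univ ∧ g.val p (X p) (X p) ≠ 0 := by
  obtain ⟨v, hv, hv0⟩ := hg.exists_singTangent_val_ne_zero hm hp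
  obtain ⟨W, hW, hWp⟩ := exists_field_apply_eq m p v
  set ρ : M → ℝ := fun q ↦ g.val q (R q) (R q) with hρdef
  have hρ : ContMDiffOn (𝓡 m) 𝓘(ℝ, ℝ) ∞ ρ U := g.contMDiffOn_val hR.1 hR.1
  have hRρ := contMDiffOn_mvfderiv_apply hρ hR.1 hU
  let V : Set M := (U ∩ {q | mvfderiv (𝓡 m) ρ q (R q) ≠ 0}) ∩ frameDomain m p
  have hV : IsOpen V :=
    (hRρ.continuousOn.isOpen_inter_preimage hU isOpen_ne).inter (isOpen_frameDomain p)
  have hVU : V ⊆ U := fun q hq ↦ hq.1.1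
  have hVp : p ∈ V :=
    ⟨⟨hpU, hg.mvfderiv_val_radical_ne_zero hU hR hp hpU⟩, mem_frameDomain p⟩
  have hWV : IsSmoothFieldOn W V := hW.mono fun q hq ↦ hq.2
  let c : M → ℝ := fun q ↦ -(mvfderiv (𝓡 m) ρ q (W q) / mvfderiv (𝓡 m) ρ q (R q))
  have hc : ContMDiffOn (𝓡 m) 𝓘(ℝ, ℝ) ∞ c V :=
    ((contMDiffOn_mvfderiv_apply (hρ.mono hVU) hWV hV).div₀ (hRρ.mono hVU)
      fun q hq ↦ hq.1.2).neg
  have hX : IsSmoothFieldOn (W + c • R) V :=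
    ContMDiffOn.add_section hWV (hc.smul_section (hR.1.mono hVU))
  obtain ⟨X, hXs, hXe, hXc⟩ := exists_field_eventuallyEq hV hVp hX
  have hker : ∀ q ∈ V, mvfderiv (𝓡 m) ρ q ((W + c • R) q) = 0 := by
    intro q hq
    have : mvfderiv (𝓡 m) ρ q (R q) ≠ 0 := hq.1.2
    simp only [Pi.add_apply, Pi.smul_apply', map_add, map_smul, smul_eq_mul, c]
    field_simp
    ring
  refine ⟨X, ⟨hXs, fun q hq ↦ ?_⟩, ?_⟩
  · change g.dGramDet q _ = 0
    rcases hXc q with h | ⟨hqV, a, h⟩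
    · rw [h, map_zero]
    · obtain ⟨b, hb, hb'⟩ := hg.exists_mvfderiv_val_eq hU hR hq.1 (hVU hqV)
      have h1 := hker q hqV
      rw [hb'] at h1
      rw [h, map_smul, (mul_eq_zero.1 h1).resolve_left hb, smul_zero]
  · obtain ⟨b, hb, hb'⟩ := hg.exists_mvfderiv_val_eq hU hR hp hpU
    have h1 : X p = v := by
      have h2 : mvfderiv (𝓡 m) ρ p v = 0 := by
        rw [hb', show g.dGramDet p v = 0 from hv, mul_zero]
      rw [hXe.self_of_nhds]
      simp [c, hWp, h2]
    rwa [h1]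

end MetricTensor

/-! ### Division on manifolds and the extended gradient -/

/-- Hadamard's lemma on a manifold: near a regular zero of `τ`, a smooth function that vanishes on
the zero set of `τ` is a smooth multiple of `τ`. -/
theorem hadamard_division {u τ : M → ℝ} {p : M} {W : Set M} (hW : IsOpen W) (hp : p ∈ W)
    (hu : ContMDiffOn (𝓡 m) 𝓘(ℝ, ℝ) ∞ u W) (hτ : ContMDiffOn (𝓡 m) 𝓘(ℝ, ℝ) ∞ τ W)
    (hτp : τ p = 0) (hd : mvfderiv (𝓡 m) τ p ≠ 0) (h0 : ∀ q ∈ W, τ q = 0 → u q = 0) :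
    ∃ (V : Set M) (w : M → ℝ), IsOpen V ∧ p ∈ V ∧ V ⊆ W ∧
      ContMDiffOn (𝓡 m) 𝓘(ℝ, ℝ) ∞ w V ∧ ∀ q ∈ V, u q = τ q * w q := by
  set φ := extChartAt (𝓡 m) p with hφ
  let O : Set (EuclideanSpace ℝ (Fin m)) := φ.target ∩ φ.symm ⁻¹' W
  have hO : IsOpen O :=
    (continuousOn_extChartAt_symm p).isOpen_inter_preimage (isOpen_extChartAt_target p) hW
  have hpφ : φ.symm (φ p) = p := extChartAt_to_inv p
  have hpO : φ p ∈ O := ⟨mem_extChartAt_target p, by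
    change φ.symm (φ p) ∈ W
    rwa [hpφ]⟩
  have hchart : ∀ {a : M → ℝ}, ContMDiffOn (𝓡 m) 𝓘(ℝ, ℝ) ∞ a W →
      ContDiffOn ℝ ∞ (a ∘ φ.symm) O := fun ha ↦
    contMDiffOn_iff_contDiffOn.1 (ha.comp ((contMDiffOn_extChartAt_symm p).mono fun z hz ↦ hz.1)
      fun z hz ↦ hz.2)
  have hτd : fderiv ℝ (τ ∘ φ.symm) (φ p) ≠ 0 := by
    have h1 := ((hτ.contMDiffAt (hW.mem_nhds hp)).mdifferentiableAt (by simp)).mvfderiv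
    rw [ModelWithCorners.Boundaryless.range_eq_univ, fderivWithin_univ] at h1
    intro h2
    exact hd (h1.trans h2)
  obtain ⟨O', w, hO', hpO', hO'O, hw, huw⟩ := hadamard_division_vectorSpace hO hpO (hchart hu)
    (hchart hτ) (by simpa [hpφ] using hτp) hτd fun z hz hz0 ↦ h0 _ hz.2 hz0
  refine ⟨φ.source ∩ φ ⁻¹' O', w ∘ φ,
    (continuousOn_extChartAt p).isOpen_inter_preimage (isOpen_extChartAt_source p) hO',
    ⟨mem_extChartAt_source p, hpO'⟩, ?_, ?_, ?_⟩
  · rintro q ⟨hq, hq'⟩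
    have h1 : φ.symm (φ q) ∈ W := (hO'O hq').2
    rwa [φ.left_inv hq] at h1
  · refine hw.contMDiffOn.comp ((contMDiffOn_extChartAt (x := p)).mono fun q hq ↦ ?_)
      fun q hq ↦ hq.2
    rw [← extChartAt_source (𝓡 m)]
    exact hq.1
  · rintro q ⟨hq, hq'⟩
    have h1 := huw _ hq'
    simpa [φ.left_inv hq] using h1

namespace MetricTensor

variable {g : MetricTensor m M}

/-- The singular set has empty interior. -/
theorem HasRegularSing.frequently_notMem_sing (hg : g.HasRegularSing) (p : M) :
    ∃ᶠ q in 𝓝 p, q ∉ g.sing := by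
  intro h
  have h' : ∀ᶠ q in 𝓝 p, q ∈ g.sing := h.mono fun q hq ↦ not_not.1 hq
  refine hg.dGramDet_ne_zero p h'.self_of_nhds ?_
  have h1 : ∀ᶠ q in 𝓝 p, g.gramDet p q = 0 := by
    filter_upwards [h', (isOpen_frameDomain (m := m) p).eventually_mem (mem_frameDomain p)]
      with q hq hq'
    exact (g.gramDet_eq_zero_iff p hq').2 hq
  rw [dGramDet, mvfderiv_congr h1, mvfderiv_const]

/-- Continuous functions that agree off `Σ` agree, because `Σ` has empty interior. -/
theorem HasRegularSing.eq_of_eq_off_sing (hg : g.HasRegularSing) {a b : M → ℝ} {p : M}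
    (ha : ContinuousAt a p) (hb : ContinuousAt b p)
    (h : ∀ᶠ q in 𝓝 p, q ∉ g.sing → a q = b q) : a p = b p :=
  tendsto_nhds_unique_of_frequently_eq ha hb
    (((hg.frequently_notMem_sing p).and_eventually h).mono fun _ hq ↦ hq.2 hq.1)

/-- The gradient of `F` extends smoothly across `Σ` if the radical directions annihilate `dF`:
in coordinates it is `adj(G) dF / det G`, and the numerator vanishes along `Σ`. -/
theorem HasRegularSing.exists_gradient (hg : g.HasRegularSing) {F : M → ℝ} {W : Set M}
    (hW : IsOpen W) (hF : ContMDiffOn (𝓡 m) 𝓘(ℝ, ℝ) ∞ F W)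
    (h0 : ∀ q ∈ g.sing ∩ W, ∀ ξ ∈ g.radical q, mvfderiv (𝓡 m) F q ξ = 0) {p : M}
    (hp : p ∈ g.sing) (hpW : p ∈ W) :
    ∃ (V : Set M) (N : Π q : M, TangentSpace (𝓡 m) q), IsOpen V ∧ p ∈ V ∧ V ⊆ W ∧
      IsSmoothFieldOn N V ∧
      ∀ q ∈ V, ∀ v : TangentSpace (𝓡 m) q, g.val q (N q) v = mvfderiv (𝓡 m) F q v := by
  let W' : Set M := W ∩ frameDomain m p
  have hW' : IsOpen W' := hW.inter (isOpen_frameDomain p)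
  have hpW' : p ∈ W' := ⟨hpW, mem_frameDomain p⟩
  have hfr : W' ⊆ frameDomain m p := fun q hq ↦ hq.2
  let d : M → Fin m → ℝ := fun q a ↦ mvfderiv (𝓡 m) F q (coordField m p a q)
  have hdF : ∀ (q : M) (c : Fin m → ℝ),
      mvfderiv (𝓡 m) F q (∑ a, c a • coordField m p a q) = c ⬝ᵥ d q := fun q c ↦ by
    simp only [map_sum, map_smul, smul_eq_mul, dotProduct, d]
  have hd : ∀ a, ContMDiffOn (𝓡 m) 𝓘(ℝ, ℝ) ∞ (fun q ↦ d q a) W' := fun a ↦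
    contMDiffOn_mvfderiv_apply (hF.mono fun q hq ↦ hq.1)
      ((isSmoothFieldOn_coordField p a).mono hfr) hW'
  -- Entry `b` of `adj(G) dF` is `dF` of row `b` of `adj(G)`, which is radical as `G` is symmetric.
  have hu0 : ∀ b, ∀ q ∈ W', g.gramDet p q = 0 →
      ((g.gramMatrix p q).adjugate.mulVec (d q)) b = 0 := by
    intro b q hq h
    have hs := (g.gramDet_eq_zero_iff p (hfr hq)).1 h
    have h1 := h0 q ⟨hs, hq.1⟩ _ (g.adjVec_mem_radical p (hfr hq) hs (Pi.single b 1))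
    have hT : (g.gramMatrix p q).transpose = g.gramMatrix p q := by
      ext i j
      exact g.symm _ _ _
    rw [adjVec, hdF, Matrix.mulVec_single_one] at h1
    rw [← h1]
    conv_lhs => rw [← hT, ← Matrix.adjugate_transpose]
    rfl
  have hdet : g.gramDet p p = 0 := (g.gramDet_eq_zero_iff p (mem_frameDomain p)).2 hp
  choose V w hV hpV hVW hw huw using fun b ↦ hadamard_division hW' hpW'
    (g.contMDiffOn_adjugate_mulVec p hfr hd b) ((g.contMDiffOn_gramDet p).mono hfr) hdet
    (hg.dGramDet_ne_zero p hp) (hu0 b)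
  let V₀ : Set M := W' ∩ ⋂ b, V b
  have hV₀ : IsOpen V₀ := hW'.inter (isOpen_iInter_of_finite hV)
  have hVb : ∀ b, V₀ ⊆ V b := fun b q hq ↦ Set.mem_iInter.1 hq.2 b
  have hV₀W' : V₀ ⊆ W' := fun q hq ↦ hq.1
  have hV₀fr : V₀ ⊆ frameDomain m p := hV₀W'.trans hfr
  -- The coordinates `w b` of the gradient are the quotients of those of `adj(G) dF` by `det G`.
  let N : Π q : M, TangentSpace (𝓡 m) q := fun q ↦ ∑ b, w b q • coordField m p b q
  have hN : IsSmoothFieldOn N V₀ := isSmoothFieldOn_sum hV₀fr fun b ↦ (hw b).mono (hVb b)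
  have hNF : ∀ q ∈ V₀, ∀ c : Fin m → ℝ, q ∉ g.sing →
      g.val q (N q) (∑ a, c a • coordField m p a q) =
        mvfderiv (𝓡 m) F q (∑ a, c a • coordField m p a q) := by
    intro q hq c hs
    have hτ : g.gramDet p q ≠ 0 := fun h ↦ hs ((g.gramDet_eq_zero_iff p (hV₀fr hq)).1 h)
    have h1 : g.adjVec p (d q) q = g.gramDet p q • N q := by
      simp only [adjVec, N, Finset.smul_sum, smul_smul]
      exact Finset.sum_congr rfl fun b _ ↦ by rw [huw b q (hVb b hq)]
    have h2 := g.val_sum_adjVec p q c (d q)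
    rw [h1, map_smul, smul_eq_mul] at h2
    rw [g.symm, hdF]
    exact mul_left_cancel₀ hτ h2
  refine ⟨V₀, N, hV₀, ⟨hpW', Set.mem_iInter.2 hpV⟩, fun q hq ↦ (hV₀W' hq).1, hN,
    fun q hq v ↦ ?_⟩
  obtain ⟨c, rfl⟩ := exists_coord p (hV₀fr hq) v
  have hc : IsSmoothFieldOn (fun q ↦ ∑ a, c a • coordField m p a q) V₀ :=
    isSmoothFieldOn_sum (c := fun a _ ↦ c a) hV₀fr fun a ↦ contMDiffOn_const
  refine hg.eq_of_eq_off_sing (a := fun q ↦ g.val q (N q) (∑ a, c a • coordField m p a q))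
    (b := fun q ↦ mvfderiv (𝓡 m) F q (∑ a, c a • coordField m p a q))
    ((g.contMDiffOn_val hN hc).continuousOn.continuousAt (hV₀.mem_nhds hq))
    ((contMDiffOn_mvfderiv_apply (hF.mono fun q hq ↦ (hV₀W' hq).1) hc
      hV₀).continuousOn.continuousAt (hV₀.mem_nhds hq)) ?_
  filter_upwards [hV₀.mem_nhds hq] with q' hq' hs
  exact hNF q' hq' c hs

end MetricTensor

/-! ### The forms `II` and `III` -/

namespace MetricTensor

variable {g g' : MetricTensor m M} {f : M → ℝ}

theorem HasRegularSing.singTangent_iff (hg : g.HasRegularSing)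
    {R : Π p : M, TangentSpace (𝓡 m) p} {U : Set M} (hU : IsOpen U)
    (hR : g.IsRadicalFieldOn R U) {p : M} (hp : p ∈ g.sing) (hpU : p ∈ U)
    (v : TangentSpace (𝓡 m) p) :
    mvfderiv (𝓡 m) (fun q ↦ g.val q (R q) (R q)) p v = 0 ↔ v ∈ g.singTangent p := by
  obtain ⟨c, hc, h⟩ := hg.exists_mvfderiv_val_eq hU hR hp hpU
  rw [h, mul_eq_zero, or_iff_right hc]
  rfl

/-- The second fundamental form of a conformal change. -/
theorem IsConformalChange.II_apply (h : IsConformalChange f g g') {p : M}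
    (hf : MDifferentiableAt (𝓡 m) 𝓘(ℝ, ℝ) f p) {R X Y : Π p : M, TangentSpace (𝓡 m) p}
    (hR : IsDiffFieldAt R p) (hX : IsDiffFieldAt X p) (hY : IsDiffFieldAt Y p)
    (hr : R p ∈ g.radical p) :
    g'.II R X Y p = Real.exp (2 * f p) *
      (g.II R X Y p - mvfderiv (𝓡 m) f p (R p) * g.val p (X p) (Y p)) := by
  unfold II
  rw [g.dualConn_conformal h hf hX hY hR, g.symm p (X p) (R p), g.symm p (Y p) (R p), hr, hr]
  ring

/-- A field tangent to `Σ` on `U` agrees, near a given point, with one on the whole of `M`. -/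
theorem IsSingTangentFieldOn.exists_extension [T2Space M] {X : Π p : M, TangentSpace (𝓡 m) p}
    {U : Set M} (hX : g.IsSingTangentFieldOn X U) (hU : IsOpen U) {p : M} (hp : p ∈ U) :
    ∃ X', g.IsSingTangentFieldOn X' Set.univ ∧ ∀ᶠ q in 𝓝 p, X' q = X q := by
  obtain ⟨X', hs, he, hc⟩ := exists_field_eventuallyEq hU hp hX.1
  refine ⟨X', ⟨hs, fun q hq ↦ ?_⟩, he⟩
  change g.dGramDet q _ = 0
  rcases hc q with h | ⟨hqU, c, h⟩
  · rw [h, map_zero]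
  · rw [h, map_smul, show g.dGramDet q (X q) = 0 from hX.2 q ⟨hq.1, hqU⟩, smul_zero]

theorem ExtendsCovDerivOn.mono [T2Space M] {X Y D X' Y' : Π p : M, TangentSpace (𝓡 m) p}
    {V V' : Set M} (h : g.ExtendsCovDerivOn X Y D V) (hV' : IsOpen V') (hVV' : V' ⊆ V)
    (hX : ∀ q ∈ V', X q = X' q) (hY : ∀ q ∈ V', Y q = Y' q) :
    g.ExtendsCovDerivOn X' Y' D V' := by
  refine ⟨h.1.mono hVV', fun q hq Z hZ ↦ ?_⟩
  obtain ⟨Z', hZ', he, -⟩ := exists_field_eventuallyEq hV' hq.1 hZ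
  have h1 := h.2 q ⟨hVV' hq.1, hq.2⟩ Z' (hZ'.mono (Set.subset_univ _))
  rw [he.self_of_nhds] at h1
  rw [h1]
  exact g.dualConn_congr ((hV'.eventually_mem hq.1).mono hX) ((hV'.eventually_mem hq.1).mono hY) he

/-- The value of `III^R(X, Y)` at `p` only depends on the germs of `X` and `Y`. -/
theorem HasIIIAt.congr [T2Space M] {R X Y X' Y' : Π p : M, TangentSpace (𝓡 m) p}
    {U U' : Set M} {p : M} {c : ℝ} (h : g.HasIIIAt U R X Y p c) (hU' : IsOpen U') (hp : p ∈ U')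
    (hX : ∀ᶠ q in 𝓝 p, X q = X' q) (hY : ∀ᶠ q in 𝓝 p, Y q = Y' q) :
    g.HasIIIAt U' R X' Y' p c := by
  obtain ⟨V, -, hV, hpV, D, hD, hc⟩ := h
  obtain ⟨O, hO, hOo, hpO⟩ := eventually_nhds_iff.1 (hX.and hY)
  have hW : IsOpen (V ∩ U' ∩ O) := (hV.inter hU').inter hOo
  exact ⟨V ∩ U' ∩ O, fun q hq ↦ hq.1.2, hW, ⟨⟨hpV, hp⟩, hpO⟩, D,
    hD.mono hW (fun q hq ↦ hq.1.1) (fun q hq ↦ (hO q hq.2).1) (fun q hq ↦ (hO q hq.2).2), hc⟩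

theorem II_self (R D : Π p : M, TangentSpace (𝓡 m) p) (p : M) :
    g.II R D R p = 1 / 2 * mvfderiv (𝓡 m) (fun q ↦ g.val q (R q) (R q)) p (D p) :=
  g.dualConn_self D R p

/-- `III^R(X, Y) = 0` means that the extension of `∇_X Y` is tangent to `Σ`, which does not depend
on the choice of the radical field. -/
theorem HasRegularSing.hasIIIAt_zero_of_radical (hg : g.HasRegularSing)
    {R R' X Y : Π p : M, TangentSpace (𝓡 m) p} {U O O' : Set M} (hO : IsOpen O)
    (hR : g.IsRadicalFieldOn R O) (hO' : IsOpen O') (hR' : g.IsRadicalFieldOn R' O') {p : M}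
    (hp : p ∈ g.sing) (hpO : p ∈ O) (hpO' : p ∈ O') (h : g.HasIIIAt U R X Y p 0) :
    g.HasIIIAt U R' X Y p 0 := by
  obtain ⟨V, hVU, hV, hpV, D, hD, hc⟩ := h
  refine ⟨V, hVU, hV, hpV, D, hD, ?_⟩
  rw [II_self, mul_eq_zero, hg.singTangent_iff hO hR hp hpO] at hc
  rw [II_self, (hg.singTangent_iff hO' hR' hp hpO' _).2 (hc.resolve_left (by norm_num)), mul_zero]

/-- The value of `III^R(X, Y)` at `p` is unique, as the singular set has empty interior. -/
theorem HasRegularSing.hasIIIAt_unique [T2Space M] (hg : g.HasRegularSing)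
    {R X Y : Π p : M, TangentSpace (𝓡 m) p} {U : Set M} (hR : IsSmoothFieldOn R U) {p : M}
    {c c' : ℝ} (h : g.HasIIIAt U R X Y p c) (h' : g.HasIIIAt U R X Y p c') : c = c' := by
  obtain ⟨V, hVU, hV, hpV, D, hD, rfl⟩ := h
  obtain ⟨V', hVU', hV', hpV', D', hD', rfl⟩ := h'
  rw [II_self, II_self]
  congr 1
  have hρ := g.contMDiffOn_val hR hR
  have hc : ∀ {V : Set M} {D : Π p : M, TangentSpace (𝓡 m) p}, IsOpen V → V ⊆ U → p ∈ V →
      IsSmoothFieldOn D V → ContinuousAt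
        (fun q ↦ mvfderiv (𝓡 m) (fun q ↦ g.val q (R q) (R q)) q (D q)) p := fun hV hVU hp hD ↦
    (contMDiffOn_mvfderiv_apply (hρ.mono hVU) hD hV).continuousOn.continuousAt (hV.mem_nhds hp)
  refine hg.eq_of_eq_off_sing (hc hV hVU hpV hD.1) (hc hV' hVU' hpV' hD'.1) ?_
  filter_upwards [hV.mem_nhds hpV, hV'.mem_nhds hpV'] with q hq hq' hs
  -- Off `Σ` the form is nondegenerate, and both fields represent the same covector `□_X Y`.
  have hDD : D q = D' q := by
    by_contra hne
    refine hs ⟨D q - D' q, fun w ↦ ?_, sub_ne_zero.2 hne⟩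
    obtain ⟨Z, hZ, rfl⟩ := exists_field_apply_eq m q w
    obtain ⟨Z', hZ', he, -⟩ := exists_field_eventuallyEq (isOpen_frameDomain q)
      (mem_frameDomain q) hZ
    rw [← he.self_of_nhds, map_sub, sub_apply,
      hD.2 q ⟨hq, hs⟩ Z' (hZ'.mono (Set.subset_univ _)),
      hD'.2 q ⟨hq', hs⟩ Z' (hZ'.mono (Set.subset_univ _)), sub_self]
  rw [hDD]

/-- The extended covariant derivative of a conformal change, in terms of the extended gradient `N`
of the conformal factor. -/
theorem ExtendsCovDerivOn.conformalChange {X Y D N : Π p : M, TangentSpace (𝓡 m) p} {V : Set M}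
    (h : g.ExtendsCovDerivOn X Y D V) (hV : IsOpen V) (hc : IsConformalChange f g g')
    (hf : ContMDiff (𝓡 m) 𝓘(ℝ, ℝ) ∞ f) (hX : IsSmoothFieldOn X V) (hY : IsSmoothFieldOn Y V)
    (hN : IsSmoothFieldOn N V)
    (hNf : ∀ q ∈ V, ∀ v : TangentSpace (𝓡 m) q, g.val q (N q) v = mvfderiv (𝓡 m) f q v) :
    g'.ExtendsCovDerivOn X Y (fun q ↦ D q + mvfderiv (𝓡 m) f q (X q) • Y q
      + mvfderiv (𝓡 m) f q (Y q) • X q + (-g.val q (X q) (Y q)) • N q) V := by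
  have hfX := contMDiffOn_mvfderiv_apply hf.contMDiffOn hX hV
  have hfY := contMDiffOn_mvfderiv_apply hf.contMDiffOn hY hV
  refine ⟨ContMDiffOn.add_section (ContMDiffOn.add_section (ContMDiffOn.add_section h.1
    (hfX.smul_section hY)) (hfY.smul_section hX))
    ((g.contMDiffOn_val hX hY).neg.smul_section hN), fun q hq Z hZ ↦ ?_⟩
  rw [hc.sing_eq] at hq
  rw [g.dualConn_conformal hc (hf.contMDiffAt.mdifferentiableAt (by simp))
    (hX.isDiffFieldAt hV hq.1) (hY.isDiffFieldAt hV hq.1) (hZ.isDiffFieldAt hV hq.1),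
    ← h.2 q hq Z hZ, hc]
  simp only [map_add, map_smul, add_apply, smul_apply, smul_eq_mul, hNf q hq.1 (Z q)]
  ring

/-- The conformal change of `III`, in terms of the extended gradient `N` of the conformal
factor. -/
theorem HasIIIAt.conformalChange [T2Space M] {X Y N R : Π p : M, TangentSpace (𝓡 m) p}
    {U W : Set M} {p : M} {c : ℝ} (hg : g.HasRegularSing) (h : g.HasIIIAt U R X Y p c)
    (hU : IsOpen U) (hW : IsOpen W)
    (hpW : p ∈ W) (hp : p ∈ g.sing) (hpU : p ∈ U) (hc : IsConformalChange f g g')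
    (hf : ContMDiff (𝓡 m) 𝓘(ℝ, ℝ) ∞ f) (hX : g.IsSingTangentFieldOn X Set.univ)
    (hY : g.IsSingTangentFieldOn Y Set.univ) (hR : g.IsRadicalFieldOn R U)
    (hN : IsSmoothFieldOn N W)
    (hNf : ∀ q ∈ W, ∀ v : TangentSpace (𝓡 m) q, g.val q (N q) v = mvfderiv (𝓡 m) f q v) :
    g'.HasIIIAt U R X Y p (Real.exp (2 * f p) * (c - g.val p (X p) (Y p) *
      (1 / 2 * mvfderiv (𝓡 m) (fun q ↦ g.val q (R q) (R q)) p (N p)))) := by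
  obtain ⟨V, hVU, hV, hpV, D, hD, rfl⟩ := h
  have hVW : IsOpen (V ∩ W) := hV.inter hW
  have hD' := hD.mono hVW Set.inter_subset_left (fun _ _ ↦ rfl) (fun _ _ ↦ rfl)
  refine ⟨V ∩ W, Set.inter_subset_left.trans hVU, hVW, ⟨hpV, hpW⟩, _,
    hD'.conformalChange hVW hc hf (hX.1.mono (Set.subset_univ _))
      (hY.1.mono (Set.subset_univ _)) (hN.mono Set.inter_subset_right)
      (fun q hq ↦ hNf q hq.2), ?_⟩
  have hr := (hR.2 p ⟨hp, hpU⟩).1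
  have hRp : IsDiffFieldAt R p := hR.1.isDiffFieldAt hU hpU
  have hfp : MDifferentiableAt (𝓡 m) 𝓘(ℝ, ℝ) f p := hf.contMDiffAt.mdifferentiableAt (by simp)
  have hX0 := (hg.singTangent_iff hU hR hp hpU (X p)).2 (hX.2 p ⟨hp, trivial⟩)
  have hY0 := (hg.singTangent_iff hU hR hp hpU (Y p)).2 (hY.2 p ⟨hp, trivial⟩)
  have hd : ∀ v, mvfderiv (𝓡 m) (fun q ↦ g'.val q (R q) (R q)) p v =
      Real.exp (2 * f p) * mvfderiv (𝓡 m) (fun q ↦ g.val q (R q) (R q)) p v := by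
    intro v
    have h1 : (fun q ↦ g'.val q (R q) (R q)) =
      fun q ↦ Real.exp (2 * f q) * g.val q (R q) (R q) := funext fun q ↦ hc q _ _
    rw [h1, mvfderiv_mul_apply (mdifferentiableAt_exp hfp) (g.mdifferentiableAt_val hRp hRp),
      hr, zero_mul, add_zero]
  rw [II_self, II_self, hd]
  simp only [map_add, map_smul, smul_eq_mul, hX0, hY0]
  ring

end MetricTensor

/-! ### Flattening conformal factors -/

omit [IsManifold (𝓡 m) ∞ M] in
/-- At a zero of `ρ` the function `ρ ψ` has differential `ψ dρ`. -/
theorem mvfderiv_mul_of_eq_zero {f ρ ψ : M → ℝ} {p : M}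
    (hρ : MDifferentiableAt (𝓡 m) 𝓘(ℝ, ℝ) ρ p) (hψ : MDifferentiableAt (𝓡 m) 𝓘(ℝ, ℝ) ψ p)
    (hf : ∀ᶠ q in 𝓝 p, f q = ρ q * ψ q) (h0 : ρ p = 0) (v : TangentSpace (𝓡 m) p) :
    mvfderiv (𝓡 m) f p v = ψ p * mvfderiv (𝓡 m) ρ p v := by
  rw [mvfderiv_congr hf, mvfderiv_mul_apply hρ hψ, h0, zero_mul, zero_add]

namespace MetricTensor

variable {g : MetricTensor m M}

/-- A conformally `II`-flat tensor becomes `II`-flat near a given singular point by the conformal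
factor `f = ρ h / R(ρ)`, where `ρ = g(R, R)`: along `Σ` it satisfies `R(f) = h`. -/
theorem HasRegularSing.exists_isIIFlatOn [T2Space M] (hg : g.HasRegularSing)
    (h : g.IsConformallyIIFlat) {p : M} (hp : p ∈ g.sing) :
    ∃ (f : M → ℝ) (U : Set M), ContMDiff (𝓡 m) 𝓘(ℝ, ℝ) ∞ f ∧ IsOpen U ∧ p ∈ U ∧
      ∀ g', IsConformalChange f g g' → g'.IsIIFlatOn U := by
  obtain ⟨R, hR, h, hh, hII⟩ := h
  obtain ⟨V, h', hV, hpV, hh', hhe⟩ := hh p hp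
  set ρ : M → ℝ := fun q ↦ g.val q (R q) (R q) with hρdef
  have hρ : ContMDiffOn (𝓡 m) 𝓘(ℝ, ℝ) ∞ ρ Set.univ := g.contMDiffOn_val hR.1 hR.1
  set a : M → ℝ := fun q ↦ mvfderiv (𝓡 m) ρ q (R q) with hadef
  have ha : ContMDiffOn (𝓡 m) 𝓘(ℝ, ℝ) ∞ a Set.univ :=
    contMDiffOn_mvfderiv_apply hρ hR.1 isOpen_univ
  have hasing : ∀ q ∈ g.sing, a q ≠ 0 := fun q hq ↦
    hg.mvfderiv_val_radical_ne_zero isOpen_univ hR hq trivial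
  let O : Set M := V ∩ {q | a q ≠ 0}
  have hO : IsOpen O := (ha.mono (Set.subset_univ V)).continuousOn.isOpen_inter_preimage hV
    isOpen_ne
  have hpO : p ∈ O := ⟨hpV, hasing p hp⟩
  have hψ : ContMDiffOn (𝓡 m) 𝓘(ℝ, ℝ) ∞ (fun q ↦ h' q / a q) O :=
    (hh'.mono Set.inter_subset_left).div₀ (ha.mono (Set.subset_univ O)) fun q hq ↦ hq.2
  obtain ⟨f, hf, hfe⟩ := exists_contMDiff_eventuallyEq hO hpO
    ((hρ.mono (Set.subset_univ O)).mul hψ)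
  obtain ⟨U, hUe, hU, hpU⟩ := eventually_nhds_iff.1 (hfe.and (hO.eventually_mem hpO))
  refine ⟨f, U, hf, hU, hpU, fun g' hc ↦ ⟨R, hc.isRadicalFieldOn (hR.mono (Set.subset_univ U)),
    fun X Y hX hY q hq ↦ ?_⟩⟩
  rw [hc.sing_eq] at hq
  have hnf : ContMDiff (𝓡 m) 𝓘(ℝ, ℝ) ∞ fun q ↦ -f q := hf.neg
  obtain ⟨X', hX', hXe⟩ := (hc.symm.isSingTangentFieldOn hnf hX).exists_extension hU hq.2
  obtain ⟨Y', hY', hYe⟩ := (hc.symm.isSingTangentFieldOn hnf hY).exists_extension hU hq.2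
  have hqO : q ∈ O := (hUe q hq.2).2
  have h1 : g.II R X Y q = h q * g.val q (X q) (Y q) := by
    rw [← hXe.self_of_nhds, ← hYe.self_of_nhds, ← hII X' Y' hX' hY' q hq.1]
    exact (g.dualConn_congr hXe hYe (.of_forall fun _ ↦ rfl)).symm
  have hρq : ρ q = 0 := (hR.2 q ⟨hq.1, trivial⟩).1 _
  have h2 : mvfderiv (𝓡 m) f q (R q) = h q := by
    rw [mvfderiv_mul_of_eq_zero
      ((hρ.contMDiffAt Filter.univ_mem).mdifferentiableAt (by simp))
      ((hψ.contMDiffAt (hO.mem_nhds hqO)).mdifferentiableAt (by simp))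
      ((hU.eventually_mem hq.2).mono fun q' hq' ↦ (hUe q' hq').1) hρq,
      ← hhe q ⟨hqO.1, hq.1⟩]
    exact div_mul_cancel₀ _ hqO.2
  rw [hc.II_apply (hf.contMDiffAt.mdifferentiableAt (by simp))
    (hR.1.isDiffFieldAt isOpen_univ trivial) (hX.1.isDiffFieldAt hU hq.2)
    (hY.1.isDiffFieldAt hU hq.2) (hR.2 q ⟨hq.1, trivial⟩).1, h1, h2, sub_self, mul_zero]

/-- The gradient `N` of `f = ρ² k / R(ρ)²` along `Σ`, where `ρ = g(R, R)` and `R` is radical: there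
`df = 0`, so that `N = ν R` is radical, and comparing the derivatives of `g(N, R) = R(f)` along `R`
gives `ν R(ρ) = R(R(f)) = 2 k`. -/
theorem HasRegularSing.mvfderiv_val_gradient (hg : g.HasRegularSing)
    {R N : Π p : M, TangentSpace (𝓡 m) p} {f ρ k : M → ℝ} {U : Set M} (hU : IsOpen U)
    (hR : g.IsRadicalFieldOn R U) (hρdef : ρ = fun q ↦ g.val q (R q) (R q))
    (hk : ContMDiffOn (𝓡 m) 𝓘(ℝ, ℝ) ∞ k U)
    (hne : ∀ q ∈ U, mvfderiv (𝓡 m) ρ q (R q) ≠ 0)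
    (hf : ∀ q ∈ U, f q = ρ q * (ρ q * (k q / mvfderiv (𝓡 m) ρ q (R q) ^ 2)))
    {p : M} (hp : p ∈ g.sing) (hpU : p ∈ U) (hN : IsDiffFieldAt N p)
    (hNf : ∀ᶠ q in 𝓝 p, ∀ v : TangentSpace (𝓡 m) q, g.val q (N q) v = mvfderiv (𝓡 m) f q v) :
    1 / 2 * mvfderiv (𝓡 m) ρ p (N p) = k p := by
  have hρ : ContMDiffOn (𝓡 m) 𝓘(ℝ, ℝ) ∞ ρ U := hρdef ▸ g.contMDiffOn_val hR.1 hR.1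
  set a : M → ℝ := fun q ↦ mvfderiv (𝓡 m) ρ q (R q) with hadef
  have ha : ContMDiffOn (𝓡 m) 𝓘(ℝ, ℝ) ∞ a U := contMDiffOn_mvfderiv_apply hρ hR.1 hU
  set φ : M → ℝ := fun q ↦ k q / a q ^ 2 with hφdef
  have hφ : ContMDiffOn (𝓡 m) 𝓘(ℝ, ℝ) ∞ φ U :=
    hk.div₀ (ha.pow 2) fun q hq ↦ pow_ne_zero 2 (hne q hq)
  have hρφ : ContMDiffOn (𝓡 m) 𝓘(ℝ, ℝ) ∞ (fun q ↦ ρ q * φ q) U := hρ.mul hφ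
  have hdiff : ∀ {u : M → ℝ}, ContMDiffOn (𝓡 m) 𝓘(ℝ, ℝ) ∞ u U → ∀ q ∈ U,
      MDifferentiableAt (𝓡 m) 𝓘(ℝ, ℝ) u q := fun hu q hq ↦
    (hu.contMDiffAt (hU.mem_nhds hq)).mdifferentiableAt (by simp)
  have hfn : ∀ q ∈ U, ∀ᶠ q' in 𝓝 q, f q' = ρ q' * (ρ q' * φ q') := fun q hq ↦
    (hU.eventually_mem hq).mono fun q' hq' ↦ hf q' hq'
  obtain ⟨hr, hr0⟩ := hR.2 p ⟨hp, hpU⟩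
  have hρp : ρ p = 0 := by
    rw [hρdef]
    exact hr _
  have hap : a p ≠ 0 := hne p hpU
  have hRp := hR.1.isDiffFieldAt hU hpU
  have hNr : N p ∈ g.radical p := fun w ↦ by
    rw [hNf.self_of_nhds, mvfderiv_mul_of_eq_zero (hdiff hρ p hpU) (hdiff hρφ p hpU)
      (hfn p hpU) hρp, hρp, zero_mul, zero_mul]
  obtain ⟨ν, hν⟩ := hg.transverse.exists_eq_smul hp hr hr0 hNr
  have h1 : mvfderiv (𝓡 m) (fun q ↦ g.val q (N q) (R q)) p (R p) = ν * a p := by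
    rw [g.mvfderiv_val_of_eq_smul hRp hN hRp hr hν, hadef, hρdef]
  -- The function `g(N, R) = R(f)` is `ρ` times the function `b` of the next line.
  set b : M → ℝ := fun q ↦ mvfderiv (𝓡 m) (fun q ↦ ρ q * φ q) q (R q) + φ q * a q with hbdef
  have hb : ContMDiffOn (𝓡 m) 𝓘(ℝ, ℝ) ∞ b U :=
    (contMDiffOn_mvfderiv_apply hρφ hR.1 hU).add (hφ.mul ha)
  have h2 : ∀ᶠ q in 𝓝 p, g.val q (N q) (R q) = ρ q * b q := by
    filter_upwards [hNf, hU.eventually_mem hpU] with q hq hqU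
    rw [hq, mvfderiv_congr (hfn q hqU), mvfderiv_mul_apply (hdiff hρ q hqU) (hdiff hρφ q hqU)]
    ring
  have h3 : b p = 2 * (φ p * a p) := by
    rw [hbdef]
    simp only
    rw [mvfderiv_mul_apply (hdiff hρ p hpU) (hdiff hφ p hpU), hρp]
    ring
  rw [mvfderiv_mul_of_eq_zero (hdiff hρ p hpU) (hdiff hb p hpU) h2 hρp, h3] at h1
  have h4 : ν = 2 * (φ p * a p) := (mul_right_cancel₀ hap h1).symm
  rw [hν, map_smul, smul_eq_mul, h4]
  change 1 / 2 * (2 * (φ p * a p) * a p) = k p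
  rw [hφdef]
  field_simp

/-- A conformally `III`-flat tensor becomes `III`-flat near a given singular point by the conformal
factor `f = ρ² k / R(ρ)²`, where `ρ = g(R, R)`. -/
theorem HasRegularSing.exists_isIIIFlatOn [T2Space M] (hg : g.HasRegularSing) {U : Set M}
    (hU : IsOpen U) (h : g.IsConformallyIIIFlatOn U) {p : M} (hp : p ∈ g.sing) (hpU : p ∈ U) :
    ∃ (f : M → ℝ) (O : Set M), ContMDiff (𝓡 m) 𝓘(ℝ, ℝ) ∞ f ∧ IsOpen O ∧ p ∈ O ∧
      ∀ g', IsConformalChange f g g' → g'.IsIIIFlatOn O := by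
  obtain ⟨⟨R₀, hR₀, hII⟩, R, hR, k, hk, hIII⟩ := h
  obtain ⟨V, k', hV, hpV, hk', hke⟩ := hk p ⟨hp, hpU⟩
  set ρ : M → ℝ := fun q ↦ g.val q (R q) (R q) with hρdef
  have hρ : ContMDiffOn (𝓡 m) 𝓘(ℝ, ℝ) ∞ ρ U := g.contMDiffOn_val hR.1 hR.1
  set a : M → ℝ := fun q ↦ mvfderiv (𝓡 m) ρ q (R q) with hadef
  have ha : ContMDiffOn (𝓡 m) 𝓘(ℝ, ℝ) ∞ a U := contMDiffOn_mvfderiv_apply hρ hR.1 hU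
  let O : Set M := (U ∩ V) ∩ {q | a q ≠ 0}
  have hO : IsOpen O := (ha.mono Set.inter_subset_left).continuousOn.isOpen_inter_preimage
    (hU.inter hV) isOpen_ne
  have hOU : O ⊆ U := fun q hq ↦ hq.1.1
  have hpO : p ∈ O := ⟨⟨hpU, hpV⟩, hg.mvfderiv_val_radical_ne_zero hU hR hp hpU⟩
  have hψ : ContMDiffOn (𝓡 m) 𝓘(ℝ, ℝ) ∞ (fun q ↦ ρ q * (k' q / a q ^ 2)) O :=
    (hρ.mono hOU).mul ((hk'.mono fun q hq ↦ hq.1.2).div₀ ((ha.mono hOU).pow 2)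
      fun q hq ↦ pow_ne_zero 2 hq.2)
  obtain ⟨f, hf, hfe⟩ := exists_contMDiff_eventuallyEq hO hpO ((hρ.mono hOU).mul hψ)
  obtain ⟨O', hO'e, hO', hpO'⟩ := eventually_nhds_iff.1 (hfe.and (hO.eventually_mem hpO))
  have hO'O : O' ⊆ O := fun q hq ↦ (hO'e q hq).2
  have hO'U : O' ⊆ U := hO'O.trans hOU
  have hfd : ∀ q, MDifferentiableAt (𝓡 m) 𝓘(ℝ, ℝ) f q := fun q ↦
    hf.contMDiffAt.mdifferentiableAt (by simp)
  have hdf : ∀ q ∈ g.sing ∩ O', ∀ v, mvfderiv (𝓡 m) f q v = 0 := by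
    intro q hq v
    have hρq : ρ q = 0 := (hR.2 q ⟨hq.1, hO'U hq.2⟩).1 _
    rw [mvfderiv_mul_of_eq_zero
      ((hρ.contMDiffAt (hU.mem_nhds (hO'U hq.2))).mdifferentiableAt (by simp))
      ((hψ.contMDiffAt (hO.mem_nhds (hO'O hq.2))).mdifferentiableAt (by simp))
      ((hO'.eventually_mem hq.2).mono fun q' hq' ↦ (hO'e q' hq').1) hρq, hρq, zero_mul, zero_mul]
  refine ⟨f, O', hf, hO', hpO', fun g' hc ↦ ?_⟩
  have hnf : ContMDiff (𝓡 m) 𝓘(ℝ, ℝ) ∞ fun q ↦ -f q := hf.neg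
  refine ⟨⟨R₀, hc.isRadicalFieldOn (hR₀.mono hO'U), fun X Y hX hY q hq ↦ ?_⟩,
    R, hc.isRadicalFieldOn (hR.mono hO'U), fun X Y hX hY q hq ↦ ?_⟩
  all_goals
    rw [hc.sing_eq] at hq
    obtain ⟨X', hX', hXe⟩ := (hc.symm.isSingTangentFieldOn hnf hX).exists_extension hO' hq.2
    obtain ⟨Y', hY', hYe⟩ := (hc.symm.isSingTangentFieldOn hnf hY).exists_extension hO' hq.2
    have hqU := hO'U hq.2
  · rw [hc.II_apply (hfd q) (hR₀.1.isDiffFieldAt hU hqU) (hX.1.isDiffFieldAt hO' hq.2)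
      (hY.1.isDiffFieldAt hO' hq.2) (hR₀.2 q ⟨hq.1, hqU⟩).1, hdf q hq, zero_mul, sub_zero]
    have h1 := hII X' Y' (hX'.mono (Set.subset_univ U)) (hY'.mono (Set.subset_univ U)) q
      ⟨hq.1, hqU⟩
    rw [show g.II R₀ X Y q = g.II R₀ X' Y' q from
      (g.dualConn_congr hXe hYe (.of_forall fun _ ↦ rfl)).symm, h1, mul_zero]
  · have h1 := hIII X' Y' (hX'.mono (Set.subset_univ U)) (hY'.mono (Set.subset_univ U)) q
      ⟨hq.1, hqU⟩
    obtain ⟨W, N, hW, hqW, hWO', hN, hNf⟩ := hg.exists_gradient hO' hf.contMDiffOn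
      (fun q hq ξ _ ↦ hdf q hq ξ) hq.1 hq.2
    have h2 := h1.conformalChange hg hU hW hqW hq.1 hqU hc hf hX' hY' hR hN hNf
    have h3 := hg.mvfderiv_val_gradient (R := R) (N := N) (f := f) (k := k') hO' (hR.mono hO'U)
      hρdef (hk'.mono fun q hq ↦ (hO'O hq).1.2) (fun q hq ↦ (hO'O hq).2)
      (fun q hq ↦ (hO'e q hq).1) hq.1 hq.2 (hN.isDiffFieldAt hW hqW)
      ((hW.eventually_mem hqW).mono hNf)
    rw [h3, hke q ⟨(hO'O hq.2).1.2, hq.1, hqU⟩, mul_comm (k q), sub_self, mul_zero] at h2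
    exact h2.congr hO' hq.2 hXe hYe

end MetricTensor

/-! ### From local flatness to global statements -/

namespace MetricTensor

variable {g g' : MetricTensor m M} {f : M → ℝ}

variable (g) in
/-- The radical vectors at `q` that point to the side of `Σ` on which `g(R, R)` is positive, for
any field `R` that extends the vector. -/
def positiveRadical (q : M) : Set (TangentSpace (𝓡 m) q) :=
  {ξ | ξ ∈ g.radical q ∧ ∃ R : Π p : M, TangentSpace (𝓡 m) p, IsDiffFieldAt R q ∧ R q = ξ ∧
    0 < mvfderiv (𝓡 m) (fun p ↦ g.val p (R p) (R p)) q ξ}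

theorem ne_zero_of_mem_positiveRadical {q : M} {ξ : TangentSpace (𝓡 m) q}
    (h : ξ ∈ g.positiveRadical q) : ξ ≠ 0 := by
  rintro rfl
  obtain ⟨-, R, -, -, h0⟩ := h
  rw [map_zero] at h0
  exact lt_irrefl _ h0

theorem smul_mem_positiveRadical {q : M} {ξ : TangentSpace (𝓡 m) q}
    (h : ξ ∈ g.positiveRadical q) {c : ℝ} (hc : 0 < c) : c • ξ ∈ g.positiveRadical q := by
  obtain ⟨hr, R, hR, rfl, h0⟩ := h
  have hcR : IsDiffFieldAt (c • R) q := mdifferentiableAt_const.smul_section (f := fun _ ↦ c) hR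
  refine ⟨g.smul_mem_radical hr c, c • R, hcR, rfl, ?_⟩
  rw [g.mvfderiv_val_of_eq_smul₂ hcR hcR hR hr (a := c) (b := c) rfl rfl, map_smul, smul_eq_mul]
  positivity

theorem HasRegularSing.convex_positiveRadical (hg : g.HasRegularSing) {q : M} (hq : q ∈ g.sing) :
    Convex ℝ (g.positiveRadical q) := by
  have key : ∀ ξ ∈ g.positiveRadical q, ∀ η ∈ g.positiveRadical q, ∃ c : ℝ, 0 < c ∧ η = c • ξ := by
    intro ξ hξ η hη
    have hξ0 := ne_zero_of_mem_positiveRadical hξ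
    obtain ⟨c, hc⟩ := hg.transverse.exists_eq_smul hq hξ.1 hξ0 hη.1
    refine ⟨c, ?_, hc⟩
    obtain ⟨hr, R, hR, rfl, h0⟩ := hξ
    obtain ⟨-, S, hS, rfl, h1⟩ := hη
    rw [g.mvfderiv_val_of_eq_smul₂ hS hS hR hr hc hc, hc, map_smul, smul_eq_mul] at h1
    by_contra hneg
    have h2 : c * c * (c * mvfderiv (𝓡 m) (fun p ↦ g.val p (R p) (R p)) q (R q)) ≤ 0 :=
      mul_nonpos_of_nonneg_of_nonpos (mul_self_nonneg c)
        (mul_nonpos_of_nonpos_of_nonneg (not_lt.1 hneg) h0.le)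
    linarith
  intro ξ hξ η hη a b ha hb hab
  obtain ⟨c, hc, rfl⟩ := key ξ hξ η hη
  have h1 : a • ξ + b • c • ξ = (a + b * c) • ξ := by rw [add_smul, smul_smul]
  rw [h1]
  refine smul_mem_positiveRadical hξ ?_
  rcases ha.eq_or_lt with rfl | ha'
  · have : b = 1 := by linarith
    simp [this, hc]
  · positivity

/-- Up to sign, a radical field is positive near a given singular point. -/
theorem HasRegularSing.exists_local_positiveRadical (hg : g.HasRegularSing)
    {R : Π p : M, TangentSpace (𝓡 m) p} {U : Set M} (hU : IsOpen U)
    (hR : g.IsRadicalFieldOn R U) {p : M} (hp : p ∈ g.sing) (hpU : p ∈ U) :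
    ∃ V ∈ 𝓝 p, ∃ S : Π p : M, TangentSpace (𝓡 m) p, IsSmoothFieldOn S V ∧
      ∀ q ∈ V, q ∈ g.sing → S q ∈ g.positiveRadical q := by
  set s : M → ℝ := fun q ↦ mvfderiv (𝓡 m) (fun p ↦ g.val p (R p) (R p)) q (R q) with hs
  have hsc : ContinuousAt s p := (contMDiffOn_mvfderiv_apply (g.contMDiffOn_val hR.1 hR.1) hR.1
    hU).continuousOn.continuousAt (hU.mem_nhds hpU)
  rcases (hg.mvfderiv_val_radical_ne_zero hU hR hp hpU).lt_or_gt with h | h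
  · have h1 : ∀ᶠ q in 𝓝 p, s q < 0 := hsc.eventually (gt_mem_nhds h)
    refine ⟨{q | q ∈ U ∧ s q < 0}, (hU.eventually_mem hpU).and h1, -R,
      (ContMDiffOn.neg_section hR.1).mono fun q hq ↦ hq.1, fun q hq hqs ↦ ?_⟩
    have hr := (hR.2 q ⟨hqs, hq.1⟩).1
    have hRq := hR.1.isDiffFieldAt hU hq.1
    have hnR : IsDiffFieldAt (-R) q := mdifferentiableAt_neg_section hRq
    have hn : (-R) q = (-1 : ℝ) • R q := by simp
    refine ⟨by rw [hn]; exact g.smul_mem_radical hr _, -R, hnR, rfl, ?_⟩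
    rw [g.mvfderiv_val_of_eq_smul₂ hnR hnR hRq hr hn hn, Pi.neg_apply, map_neg]
    have h2 : s q < 0 := hq.2
    simp only [hs] at h2
    linarith
  · have h1 : ∀ᶠ q in 𝓝 p, 0 < s q := hsc.eventually (lt_mem_nhds h)
    exact ⟨{q | q ∈ U ∧ 0 < s q}, (hU.eventually_mem hpU).and h1, R,
      hR.1.mono fun q hq ↦ hq.1, fun q hq hqs ↦ ⟨(hR.2 q ⟨hqs, hq.1⟩).1, R,
        hR.1.isDiffFieldAt hU hq.1, rfl, hq.2⟩⟩

variable (g) in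
theorem isClosed_sing : IsClosed g.sing := by
  rw [← isOpen_compl_iff, isOpen_iff_mem_nhds]
  intro p hp
  have h := (g.contMDiffOn_gramDet p).continuousOn.isOpen_inter_preimage (isOpen_frameDomain p)
    (isOpen_ne (x := (0 : ℝ)))
  refine Filter.mem_of_superset (h.mem_nhds ⟨mem_frameDomain p, fun h0 ↦ hp ?_⟩) ?_
  · exact (g.gramDet_eq_zero_iff p (mem_frameDomain p)).1 h0
  · exact fun q hq hqs ↦ hq.2 ((g.gramDet_eq_zero_iff p hq.1).2 hqs)

/-- Local radical fields can be patched to a global one, after they have been oriented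
consistently. -/
theorem HasRegularSing.exists_global_radical [T2Space M] [SecondCountableTopology M]
    (hg : g.HasRegularSing)
    (h : ∀ p ∈ g.sing, ∃ (U : Set M) (R : Π p : M, TangentSpace (𝓡 m) p), IsOpen U ∧ p ∈ U ∧
      g.IsRadicalFieldOn R U) : ∃ R, g.IsRadicalFieldOn R Set.univ := by
  have : LocallyCompactSpace M := ChartedSpace.locallyCompactSpace (EuclideanSpace ℝ (Fin m)) M
  obtain ⟨R, hR⟩ := exists_contMDiffSection_forall_mem_convex_of_local (n := ⊤) (𝓡 m)
    (TangentSpace (𝓡 m) : M → Type _) (F_fiber := EuclideanSpace ℝ (Fin m))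
    (fun q ↦ {ξ | q ∈ g.sing → ξ ∈ g.positiveRadical q}) (fun q ↦ by
      by_cases hq : q ∈ g.sing
      · simpa [hq] using hg.convex_positiveRadical hq
      · simpa [hq] using convex_univ) (fun p ↦ by
      by_cases hp : p ∈ g.sing
      · obtain ⟨U, R, hU, hpU, hR⟩ := h p hp
        exact hg.exists_local_positiveRadical hU hR hp hpU
      · exact ⟨g.singᶜ, g.isClosed_sing.isOpen_compl.mem_nhds hp, 0,
          (Bundle.contMDiff_zeroSection ℝ _).contMDiffOn, fun q hq hqs ↦ absurd hqs hq⟩)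
  exact ⟨R, R.contMDiff.contMDiffOn, fun q hq ↦
    ⟨(hR q hq.1).1, ne_zero_of_mem_positiveRadical (hR q hq.1)⟩⟩

/-- If `e^{2f} g` is `II`-flat on `U`, then `II^R = R(f) g` along `Σ ∩ U`, for every radical
field `R`. -/
theorem HasRegularSing.II_eq_of_isIIFlatOn (hg : g.HasRegularSing)
    (hc : IsConformalChange f g g') (hf : ContMDiff (𝓡 m) 𝓘(ℝ, ℝ) ∞ f) {U O : Set M}
    (hU : IsOpen U) (hO : IsOpen O) (h : g'.IsIIFlatOn U)
    {R X Y : Π p : M, TangentSpace (𝓡 m) p} (hR : g.IsRadicalFieldOn R O)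
    (hX : g.IsSingTangentFieldOn X Set.univ) (hY : g.IsSingTangentFieldOn Y Set.univ) {q : M}
    (hq : q ∈ g.sing) (hqU : q ∈ U) (hqO : q ∈ O) :
    g.II R X Y q = mvfderiv (𝓡 m) f q (R q) * g.val q (X q) (Y q) := by
  obtain ⟨R', hR', hII⟩ := h
  have hR'g : g.IsRadicalFieldOn R' U := hc.symm.isRadicalFieldOn hR'
  have hXq := hX.1.isDiffFieldAt isOpen_univ (Set.mem_univ q)
  have hYq := hY.1.isDiffFieldAt isOpen_univ (Set.mem_univ q)
  have hRq' := hR'.1.isDiffFieldAt hU hqU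
  obtain ⟨hr', hr0'⟩ := hR'g.2 q ⟨hq, hqU⟩
  obtain ⟨c, hcR⟩ := hg.transverse.exists_eq_smul hq hr' hr0' (hR.2 q ⟨hq, hqO⟩).1
  have h1 := hII X Y ((hc.isSingTangentFieldOn hf hX).mono (Set.subset_univ U))
    ((hc.isSingTangentFieldOn hf hY).mono (Set.subset_univ U)) q ⟨by rwa [hc.sing_eq], hqU⟩
  rw [hc.II_apply (hf.contMDiffAt.mdifferentiableAt (by simp)) hRq' hXq hYq hr', mul_eq_zero,
    or_iff_right (Real.exp_ne_zero _), sub_eq_zero] at h1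
  unfold II at h1 ⊢
  rw [g.dualConn_of_eq_smul hXq hYq hRq' (hR.1.isDiffFieldAt hO hqO) hcR, h1, hcR, map_smul,
    smul_eq_mul, mul_assoc]

/-- Conformal `II`-flatness can be checked locally. -/
theorem HasRegularSing.isConformallyIIFlat_of_local [T2Space M] [SecondCountableTopology M]
    (hg : g.HasRegularSing) (hm : 2 ≤ m)
    (h : ∀ p ∈ g.sing, ∃ (U : Set M) (f : M → ℝ) (g' : MetricTensor m M), IsOpen U ∧ p ∈ U ∧
      ContMDiff (𝓡 m) 𝓘(ℝ, ℝ) ∞ f ∧ IsConformalChange f g g' ∧ g'.IsIIFlatOn U) :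
    g.IsConformallyIIFlat := by
  -- With `f q` the local function chosen at `q`, the coefficient of `II^R` at `q` is `R(f q)`.
  choose! U f g' hU hpU hf hc hII using h
  obtain ⟨R, hR⟩ := hg.exists_global_radical fun p hp ↦ by
    obtain ⟨R, hR, -⟩ := hII p hp
    exact ⟨U p, R, hU p hp, hpU p hp, (hc p hp).symm.isRadicalFieldOn hR⟩
  have key : ∀ p ∈ g.sing, ∀ X Y, g.IsSingTangentFieldOn X Set.univ →
      g.IsSingTangentFieldOn Y Set.univ → ∀ q ∈ g.sing, q ∈ U p →
      g.II R X Y q = mvfderiv (𝓡 m) (f p) q (R q) * g.val q (X q) (Y q) :=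
    fun p hp X Y hX hY q hq hqU ↦ hg.II_eq_of_isIIFlatOn (hc p hp) (hf p hp) (hU p hp)
      isOpen_univ (hII p hp) hR hX hY hq hqU trivial
  refine ⟨R, hR, fun q ↦ mvfderiv (𝓡 m) (f q) q (R q), fun p hp ↦ ?_,
    fun X Y hX hY q hq ↦ key q hq X Y hX hY q hq (hpU q hq)⟩
  refine ⟨U p, fun q ↦ mvfderiv (𝓡 m) (f p) q (R q), hU p hp, hpU p hp,
    contMDiffOn_mvfderiv_apply (hf p hp).contMDiffOn (hR.1.mono (Set.subset_univ _)) (hU p hp),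
    fun q hq ↦ ?_⟩
  obtain ⟨X, hX, hX0⟩ := hg.exists_isSingTangentFieldOn hm isOpen_univ hR hq.2 trivial
  have h1 := key p hp X X hX hX q hq.2 hq.1
  rw [key q hq.2 X X hX hX q hq.2 (hpU q hq.2)] at h1
  exact (mul_right_cancel₀ hX0 h1).symm

/-- The proportionality of `III^R` and `g_Σ` can be checked locally. -/
theorem HasRegularSing.exists_III_eq_of_local [T2Space M] (hg : g.HasRegularSing) (hm : 2 ≤ m)
    {R : Π p : M, TangentSpace (𝓡 m) p} {U : Set M} (hU : IsOpen U)
    (hR : g.IsRadicalFieldOn R U)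
    (h : ∀ p ∈ g.sing ∩ U, ∃ (V : Set M) (k : M → ℝ), IsOpen V ∧ p ∈ V ∧
      ContMDiffOn (𝓡 m) 𝓘(ℝ, ℝ) ∞ k V ∧
      ∀ X Y, g.IsSingTangentFieldOn X U → g.IsSingTangentFieldOn Y U → ∀ q ∈ g.sing ∩ U, q ∈ V →
        g.HasIIIAt U R X Y q (k q * g.val q (X q) (Y q))) :
    ∃ k : M → ℝ, IsSmoothFunctionOnSubset m k (g.sing ∩ U) ∧
      ∀ X Y, g.IsSingTangentFieldOn X U → g.IsSingTangentFieldOn Y U →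
        ∀ p ∈ g.sing ∩ U, g.HasIIIAt U R X Y p (k p * g.val p (X p) (Y p)) := by
  choose! V k hV hpV hk hIII using h
  refine ⟨fun q ↦ k q q, fun p hp ↦ ⟨V p, k p, hV p hp, hpV p hp, hk p hp, fun q hq ↦ ?_⟩,
    fun X Y hX hY p hp ↦ hIII p hp X Y hX hY p hp (hpV p hp)⟩
  obtain ⟨X, hX, hX0⟩ := hg.exists_isSingTangentFieldOn hm hU hR hq.2.1 hq.2.2
  have hXU := hX.mono (Set.subset_univ U)
  exact mul_right_cancel₀ hX0 (hg.hasIIIAt_unique hR.1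
    (hIII p hp X X hXU hXU q hq.2 hq.1) (hIII q hq.2 X X hXU hXU q hq.2 (hpV q hq.2)))

/-- Around a point at which some conformal change `g' = e^{2f} g` of a `II`-flat tensor `g` is
`III`-flat, the form `III^R` of `g` is a multiple of `g_Σ`. -/
theorem HasRegularSing.exists_local_III_eq [T2Space M] (hg : g.HasRegularSing) (hm : 2 ≤ m)
    (hc : IsConformalChange f g g') (hf : ContMDiff (𝓡 m) 𝓘(ℝ, ℝ) ∞ f) {U U' : Set M}
    (hU : IsOpen U) (hU' : IsOpen U') (h : g.IsIIFlatOn U) (h' : g'.IsIIIFlatOn U')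
    {R : Π p : M, TangentSpace (𝓡 m) p} (hR : g.IsRadicalFieldOn R U) {p : M}
    (hp : p ∈ g.sing ∩ U) (hpU' : p ∈ U') :
    ∃ (V : Set M) (k : M → ℝ), IsOpen V ∧ p ∈ V ∧ ContMDiffOn (𝓡 m) 𝓘(ℝ, ℝ) ∞ k V ∧
      ∀ X Y, g.IsSingTangentFieldOn X U → g.IsSingTangentFieldOn Y U → ∀ q ∈ g.sing ∩ U, q ∈ V →
        g.HasIIIAt U R X Y q (k q * g.val q (X q) (Y q)) := by
  have hnf : ContMDiff (𝓡 m) 𝓘(ℝ, ℝ) ∞ fun q ↦ -f q := hf.neg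
  have hg' := hc.hasRegularSing hf hg
  have hR' : g'.IsRadicalFieldOn R U := hc.isRadicalFieldOn hR
  have hcs := hc.symm
  obtain ⟨hII', R', hR'', hIII⟩ := h'
  -- Both tensors are `II`-flat, so that the radical annihilates `df`.
  have hrad : ∀ q ∈ g'.sing ∩ (U ∩ U'), ∀ ξ ∈ g'.radical q,
      mvfderiv (𝓡 m) (fun q ↦ -f q) q ξ = 0 := by
    intro q hq ξ hξ
    have hqs : q ∈ g.sing := by rw [← hc.sing_eq]; exact hq.1
    obtain ⟨hr, hr0⟩ := hR'.2 q ⟨hq.1, hq.2.1⟩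
    obtain ⟨X, hX, hX0⟩ := hg'.exists_isSingTangentFieldOn hm hU hR' hq.1 hq.2.1
    have h1 := hg'.II_eq_of_isIIFlatOn hcs hnf hU hU h hR' hX hX hq.1 hq.2.1 hq.2.1
    -- `g'` is a conformal change of itself by the zero function, so its `II` vanishes for each `R`.
    have h2 : g'.II R X X q = 0 := by
      have hXg := hcs.isSingTangentFieldOn hnf hX
      have hXq := hX.1.isDiffFieldAt isOpen_univ (Set.mem_univ q)
      have hRq := hR.1.isDiffFieldAt hU hq.2.1
      obtain ⟨hs, hs0⟩ := hR''.2 q ⟨hq.1, hq.2.2⟩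
      have h3 : IsConformalChange (fun _ ↦ (0 : ℝ)) g' g' := fun p v w ↦ by simp
      rw [hg'.II_eq_of_isIIFlatOn h3 contMDiff_const hU' hU hII' hR' hX hX hq.1 hq.2.2 hq.2.1,
        mvfderiv_const]
      simp
    rw [h2] at h1
    have h4 := (mul_eq_zero.1 h1.symm).resolve_right hX0
    obtain ⟨c, rfl⟩ := hg'.transverse.exists_eq_smul hq.1 hr hr0 hξ
    rw [map_smul, h4, smul_zero]
  have hps : p ∈ g'.sing := by rw [hc.sing_eq]; exact hp.1
  obtain ⟨V, N, hV, hpV, hVU, hN, hNf⟩ := hg'.exists_gradient (hU.inter hU') hnf.contMDiffOn hrad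
    hps ⟨hp.2, hpU'⟩
  have hVU₁ : V ⊆ U := fun q hq ↦ (hVU hq).1
  refine ⟨V, fun q ↦ -(1 / 2 * mvfderiv (𝓡 m) (fun q ↦ g'.val q (R q) (R q)) q (N q)), hV, hpV,
    (contMDiffOn_const.mul (contMDiffOn_mvfderiv_apply ((g'.contMDiffOn_val hR.1 hR.1).mono hVU₁)
      hN hV)).neg, fun X Y hX hY q hq hqV ↦ ?_⟩
  have hqs : q ∈ g'.sing := by rw [hc.sing_eq]; exact hq.1
  have hqU' : q ∈ U' := (hVU hqV).2
  obtain ⟨X', hX', hXe⟩ := (hc.isSingTangentFieldOn hf hX).exists_extension hU hq.2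
  obtain ⟨Y', hY', hYe⟩ := (hc.isSingTangentFieldOn hf hY).exists_extension hU hq.2
  have h1 := (hg'.hasIIIAt_zero_of_radical hU' hR'' hU hR' hqs hqU' hq.2
    (hIII X' Y' (hX'.mono (Set.subset_univ _)) (hY'.mono (Set.subset_univ _)) q
      ⟨hqs, hqU'⟩)).congr hU hq.2 (.of_forall fun _ ↦ rfl) (.of_forall fun _ ↦ rfl)
  have h2 := h1.conformalChange hg' hU hV hqV hqs hq.2 hcs hnf hX' hY' hR' hN hNf
  have h3 := h2.congr hU hq.2 hXe hYe
  convert h3 using 1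
  rw [hXe.self_of_nhds, hYe.self_of_nhds, hcs q (X q) (Y q)]
  ring

end MetricTensor

end RiemannLorentz

end

theorem proposition3p4 {m : ℕ} (hm : 2 ≤ m) {M : Type*} [TopologicalSpace M]
    [T2Space M] [SecondCountableTopology M] [ConnectedSpace M]
    [ChartedSpace (EuclideanSpace ℝ (Fin m)) M] [IsManifold (𝓡 m) ∞ M]
    (g₀ : RiemannLorentz.MetricTensor m M)
    (hg₀ : g₀.IsTransverseRiemannLorentz) (hrad : g₀.HasTransverseRadical) :
    RiemannLorentz.IsConformallyIIIFlatClass g₀.conformalClass ↔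
      ∀ p ∈ g₀.sing, ∃ U : Set M, IsOpen U ∧ p ∈ U ∧
        ∃ g ∈ g₀.conformalClass, g.IsIIIFlatOn U := by
  open RiemannLorentz MetricTensor in
  have hg : g₀.HasRegularSing := ⟨hg₀.dGramDet_ne_zero, hrad⟩
  constructor
  · rintro ⟨⟨g₁, ⟨f₁, hf₁, hc₁⟩, hflat⟩, hIII⟩ p hp
    change IsConformalChange f₁ g₀ g₁ at hc₁
    have hg₁ := hc₁.hasRegularSing hf₁ hg
    have hp₁ : p ∈ g₁.sing := by rwa [hc₁.sing_eq]
    obtain ⟨f₂, U, hf₂, hU, hpU, h₂⟩ := hg₁.exists_isIIFlatOn hflat hp₁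
    obtain ⟨g₂, hc₂⟩ := exists_isConformalChange g₁ hf₂
    have hg₂ := hc₂.hasRegularSing hf₂ hg₁
    have hp₂ : p ∈ g₂.sing := by rwa [hc₂.sing_eq]
    have hconf := hIII g₂ ⟨_, hf₁.add hf₂, hc₁.trans hc₂⟩ U hU (h₂ g₂ hc₂)
    obtain ⟨f₃, O, hf₃, hO, hpO, h₃⟩ := hg₂.exists_isIIIFlatOn hU hconf hp₂ hpU
    obtain ⟨g₃, hc₃⟩ := exists_isConformalChange g₂ hf₃
    exact ⟨O, hO, hpO, g₃, ⟨_, (hf₁.add hf₂).add hf₃, (hc₁.trans hc₂).trans hc₃⟩, h₃ g₃ hc₃⟩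
  · intro h
    refine ⟨⟨g₀, ⟨fun _ ↦ 0, contMDiff_const, fun p v w ↦ by simp⟩,
      hg.isConformallyIIFlat_of_local hm fun p hp ↦ ?_⟩, ?_⟩
    · obtain ⟨U, hU, hpU, g, ⟨f, hf, hc⟩, hflat⟩ := h p hp
      exact ⟨U, f, g, hU, hpU, hf, hc, hflat.1⟩
    · rintro g ⟨f, hf, hc⟩ U hU hflat
      change IsConformalChange f g₀ g at hc
      have hg' := hc.hasRegularSing hf hg
      refine ⟨hflat, ?_⟩
      obtain ⟨R, hR, -⟩ := id hflat
      refine ⟨R, hR, hg'.exists_III_eq_of_local hm hU hR fun p hp ↦ ?_⟩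
      obtain ⟨U', hU', hpU', g', ⟨f', hf', hc'⟩, hflat'⟩ := h p (by rw [← hc.sing_eq]; exact hp.1)
      change IsConformalChange f' g₀ g' at hc'
      have hnf : ContMDiff (𝓡 m) 𝓘(ℝ, ℝ) ∞ fun q ↦ -f q := hf.neg
      exact hg'.exists_local_III_eq hm (hc.symm.trans hc') (hnf.add hf') hU hU' hflat hflat' hR hp
        hpU'
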